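/- **Setting.** Let $M$ be a von Neumann algebra with a faithful normal tracial state $\tau$, and let $L^1(M,\tau)$ be the completion of $M$ in the norm $\|a\|_1=\tau(|a|)$; the functional $\tau$, the pairing $\tau(xa)$ ($x\in L^1(M,\tau)$, $a\in M$) and the products $axb$ ($a,b\in M$) are extended to $x\in L^1(M,\tau)$ by continuity. Assume that $L^1(M,\tau)$ is separable. Write $\|\cdot\|_\infty$ for the operator norm of $M$, $L^1(M,\tau)_+=\{x:\tau(xa)\ge 0\ \forall a\in M_+\}$, $x\le y$ if $y-x\in L^1(M,\tau)_+$, $S=\{x\in L^1(M,\tau)_+:\tau(x)=1\}$ and $S_b=S\cap M$. For $x,y\in S$ put $$m(x,y)=\max\{\lambda\in\mathbb R:\lambda y\le x\},\qquad d(x,y)=\frac{1-m(x,y)m(y,x)}{1+m(x,y)m(y,x)} .$$ A linear map $\gamma$ on $L^1(M,\tau)$ is positive if $\gamma(L^1(M,\tau)_+)\subset L^1(M,\tau)_+$, faithful if $\gamma(x)\neq0$ for every non-zero $x\in L^1(M,\tau)_+$, and $M$-preserving if $\gamma(M)\subset M$. For faithful positive $\gamma$ and $x\in S$ put $\gamma\cdot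 x=\gamma(x)/\tau(\gamma(x))$; such a $\gamma$ belongs to $SHC(M)$ (the strict Hennion contractions) if $$c(\gamma)=\sup_{x\ne y\in S}\frac{d(\gamma\cdot x,\gamma\cdot y)}{d(x,y)}<1 .$$ For a bounded linear map $\gamma$ on $L^1(M,\tau)$, $\gamma^*\colon M\to M$ is the dual map, $\tau(\gamma(x)a)=\tau(x\gamma^*(a))$, and $\gamma^*\cdot b=\gamma^*(b)/\tau(\gamma^*(b))$ for $b\in S_b$. An element $x\in L^1(M,\tau)$ is boundedly invertible if it has an inverse in $M$. A random variable in $L^1(M,\tau)$ is an almost sure $\|\cdot\|_1$-limit of simple functions. **Theorem.** Let $(\Omega,\mathbb P)$ be a probability space with an ergodic automorphism $T$ (an invertible, bimeasurable, measure preserving, ergodic map). Let $\gamma_\omega\colon L^1(M,\tau)\to L^1(M,\tau)$, $\omega\in\Omega$, be an $M$-preserving bounded positive faithful random linear operator; that is, $\omega\mapsto\gamma_\omega(x)$ is a random variable for each $x$, and for almost every $\omega$ the map $\gamma_\omega$ is linear, bounded, positive, faithful and $M$-preserving. Put $\Gamma_{n,m}(\omega)=\gamma_{T^n\omega}\circ\gamma_{T^{n-1}\omega}\circ\cdots\circ\gamma_{T^m\omega}$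 for integers $n\ge m$. Suppose that $\gamma_\omega(1)$ is boundedly invertible almost surely and that $$\mathbb P\big[\exists\, n,m\in\mathbb Z:\ n\ge m\text{ and }\Gamma_{n,m}\in SHC(M)\big]>0 .$$ Then there are random variables $B_m\colon\Omega\to S_b$, $m\in\mathbb Z$, such that: 1. almost surely, for all $m\in\mathbb Z$, $\ \gamma_{T^{m-1}\omega}^*\cdot B_m(\omega)=B_{m-1}(\omega)$ and $B_m(T^{\pm1}\omega)=B_{m\pm1}(\omega)$; 2. for every $a\in M$, almost surely, for all $m\in\mathbb Z$, $$\lim_{n\to+\infty}\Big\|\Gamma_{n,m}(1)^{-\frac12}\,\Gamma_{n,m}(a)\,\Gamma_{n,m}(1)^{-\frac12}-\tau(aB_m)1\Big\|_\infty=0 ;$$ 3. whenever $m\in\mathbb Z$ is such that $\sup_{n\ge m}\|\Gamma_{n,m}^*(\Gamma_{n,m}(1)^{-1})\|_\infty<\infty$ almost surely, then for every $x\in S$, almost surely, $$\lim_{n\to+\infty}\Big\|\Gamma_{n,m}(1)^{-\frac12}\,\Gamma_{n,m}(x)\,\Gamma_{n,m}(1)^{-\frac12}-\tau(xB_m)1\Big\|_1=0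 .$$ -/

import Mathlib

open scoped ComplexOrder


namespace EQP
set_option linter.unusedSectionVars false


/-! ### Von Neumann algebras as ordered C*-algebras

Mathlib's `VonNeumannAlgebra H` is a `*`-subalgebra of `B(H)` equal to its double commutant. The
first block of instances equips it with the structure (norm, order) that it inherits from `B(H)`. -/

section VN
variable {H : Type*} [NormedAddCommGroup H] [InnerProductSpace ℂ H] [CompleteSpace H]

instance instSMulMemClass : SMulMemClass (VonNeumannAlgebra H) ℂ (H →L[ℂ] H) where
  smul_mem {S} r _ hx := S.toStarSubalgebra.smul_mem hx r

instance instIsClosed (M : VonNeumannAlgebra H) : IsClosed (M : Set (H →L[ℂ] H)) := by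
  rw [← M.centralizer_centralizer]
  exact Set.isClosed_centralizer _


lemma sqrt_mem (M : VonNeumannAlgebra H) {a : H →L[ℂ] H} (ha : a ∈ M) :
    CFC.sqrt a ∈ M := by
  rw [← SetLike.mem_coe, ← M.centralizer_centralizer]
  intro z hz
  have h : Commute a z := hz a ha
  have : Commute (CFC.sqrt a) z := h.cfcₙ_nnreal _
  exact this.symm

instance instStarOrderedRing (M : VonNeumannAlgebra H) : StarOrderedRing M := by
  refine StarOrderedRing.of_le_iff fun x y => ⟨fun h => ?_, ?_⟩
  · have h' : (0 : H →L[ℂ] H) ≤ (y : H →L[ℂ] H) - x := sub_nonneg.2 h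
    refine ⟨⟨CFC.sqrt ((y : H →L[ℂ] H) - x), sqrt_mem M (sub_mem y.2 x.2)⟩, Subtype.ext ?_⟩
    have h1 := CFC.sqrt_mul_sqrt_self _ h'
    have h2 : star (CFC.sqrt ((y : H →L[ℂ] H) - x)) = CFC.sqrt ((y : H →L[ℂ] H) - x) :=
      (CFC.sqrt_nonneg _).isSelfAdjoint.star_eq
    change (y : H →L[ℂ] H) = x + star (CFC.sqrt ((y : H →L[ℂ] H) - x)) * CFC.sqrt ((y : H →L[ℂ] H) - x)
    rw [h2, h1]; abel
  · rintro ⟨s, rfl⟩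
    change (x : H →L[ℂ] H) ≤ x + star (s : H →L[ℂ] H) * s
    exact le_add_of_nonneg_right (star_mul_self_nonneg _)

/-- A functional on a von Neumann algebra is *normal* if it is `σ`-weakly (ultraweakly) continuous,
that is, of the form `a ↦ ∑ₙ ⟨η n, a (ξ n)⟩` with `∑ ‖ξ n‖² < ∞` and `∑ ‖η n‖² < ∞`. -/
def IsNormal (M : VonNeumannAlgebra H) (φ : M → ℂ) : Prop :=
  ∃ ξ η : ℕ → H, Summable (fun n => ‖ξ n‖ ^ 2) ∧ Summable (fun n => ‖η n‖ ^ 2) ∧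
    ∀ a : M, HasSum (fun n => inner ℂ (η n) ((a : H →L[ℂ] H) (ξ n))) (φ a)

end VN

/-! ### Faithful tracial states and the norm `‖a‖₁ = τ(|a|)` -/

section tr
variable {A : Type*} [CStarAlgebra A] [PartialOrder A] [StarOrderedRing A]

/-- A faithful tracial state on a unital C*-algebra. -/
structure FaithfulTrace (A : Type*) [CStarAlgebra A] [PartialOrder A] extends A →ₚ[ℂ] ℂ where
  map_one' : toFun 1 = 1
  tracial' : ∀ a b, toFun (a * b) = toFun (b * a)
  faithful' : ∀ a, 0 ≤ a → toFun a = 0 → a = 0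

namespace FaithfulTrace
noncomputable instance : CoeFun (FaithfulTrace A) (fun _ => A → ℂ) := ⟨fun τ => τ.toPositiveLinearMap⟩

variable (τ : FaithfulTrace A)

lemma map_one : τ 1 = 1 := τ.map_one'
lemma tracial (a b : A) : τ (a * b) = τ (b * a) := τ.tracial' a b
lemma faithful {a : A} (h : 0 ≤ a) (h0 : τ a = 0) : a = 0 := τ.faithful' a h h0

/-- `‖a‖₁ = τ(|a|)`, where `|a| = (a* a)^{1/2}`. -/
noncomputable def norm₁ (a : A) : ℝ := (τ (CFC.abs a)).re

lemma cauchy_schwarz (a b : A) :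
    ‖τ (star a * b)‖ ≤ √(τ (star a * a)).re * √(τ (star b * b)).re := by
  have h := norm_inner_le_norm (𝕜 := ℂ) (τ.toPositiveLinearMap.toPreGNS a)
    (τ.toPositiveLinearMap.toPreGNS b)
  simpa [PositiveLinearMap.preGNS_inner_def, PositiveLinearMap.preGNS_norm_def] using h

lemma re_mono {a b : A} (h : a ≤ b) : (τ a).re ≤ (τ b).re :=
  (Complex.le_def.1 (OrderHomClass.mono τ.toPositiveLinearMap h)).1


lemma spec_nonneg {h : A} (hh : 0 ≤ h) {x : ℝ} (hx : x ∈ spectrum ℝ h) : 0 ≤ x :=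
  spectrum_nonneg_of_nonneg hh hx

lemma norm_mul_le_aux (a b : A) {ε : ℝ} (hε : 0 < ε) :
    ‖τ (a * b)‖ ≤ √(τ.norm₁ a) * (‖b‖ * √(τ.norm₁ a + ε)) := by
  set h := CFC.abs a with hdef
  have hh : 0 ≤ h := CFC.abs_nonneg a
  have hpos : ∀ x ∈ spectrum ℝ h, 0 < x + ε := fun x hx => by
    have := spec_nonneg hh hx; linarith
  set r := cfc (fun x : ℝ => √(x + ε)) h with hr
  set q := cfc (fun x : ℝ => (√(x + ε))⁻¹) h with hq
  have cr : ContinuousOn (fun x : ℝ => √(x + ε)) (spectrum ℝ h) := by fun_prop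
  have cq : ContinuousOn (fun x : ℝ => (√(x + ε))⁻¹) (spectrum ℝ h) :=
    cr.inv₀ fun x hx => (Real.sqrt_pos.2 (hpos x hx)).ne'
  have sr : star r = r := (cfc_predicate (R := ℝ) (p := IsSelfAdjoint) _ h).star_eq
  have sq : star q = q := (cfc_predicate (R := ℝ) (p := IsSelfAdjoint) _ h).star_eq
  have hqr : q * r = 1 := by
    rw [hq, hr, ← cfc_mul _ _ h cq cr, ← cfc_one ℝ h]
    exact cfc_congr fun x hx => inv_mul_cancel₀ (Real.sqrt_pos.2 (hpos x hx)).ne'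
  have hrr : r * r = h + algebraMap ℝ A ε := by
    rw [hr, ← cfc_mul _ _ h cr cr]
    calc _ = cfc (fun x : ℝ => x + ε) h :=
          cfc_congr fun x hx => Real.mul_self_sqrt (hpos x hx).le
      _ = _ := by rw [cfc_add_const ε (fun x : ℝ => x) h, cfc_id' ℝ h]
  have hhq : h * h * (q * q) ≤ h := by
    have e : h * h * (q * q) = cfc (fun x : ℝ => x * x * ((√(x + ε))⁻¹ * (√(x + ε))⁻¹)) h := by
      have c1 : ContinuousOn (fun x : ℝ => x * x) (spectrum ℝ h) := by fun_prop
      have c2 : ContinuousOn (fun x : ℝ => x) (spectrum ℝ h) := by fun_prop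
      have c3 : ContinuousOn (fun x : ℝ => (√(x + ε))⁻¹ * (√(x + ε))⁻¹) (spectrum ℝ h) := cq.mul cq
      rw [cfc_mul _ _ h c1 c3, cfc_mul _ _ h c2 c2, cfc_mul _ _ h cq cq, cfc_id' ℝ h]
    rw [e]
    conv_rhs => rw [← cfc_id' ℝ h]
    refine cfc_mono (fun x hx => ?_) ((continuousOn_id.mul continuousOn_id).mul (cq.mul cq))
      (by fun_prop)
    have h0 := spec_nonneg hh hx
    have h1 := hpos x hx
    rw [← mul_inv, Real.mul_self_sqrt h1.le, ← div_eq_mul_inv, div_le_iff₀ h1]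
    nlinarith
  have key := τ.cauchy_schwarz (star (a * q)) (r * b)
  rw [star_star, show a * q * (r * b) = a * b by
    rw [mul_assoc, ← mul_assoc q, hqr, one_mul]] at key
  refine key.trans ?_
  gcongr
  · rw [star_mul, sq, show a * q * (q * star a) = (a * (q * q)) * star a by simp only [mul_assoc],
      τ.tracial, ← mul_assoc, ← CFC.abs_mul_abs]
    exact τ.re_mono hhq
  · rw [star_mul, sr, show star b * r * (r * b) = (star b * (r * r)) * b by simp only [mul_assoc],
      τ.tracial, show b * (star b * (r * r)) = (b * star b * r) * r by simp only [mul_assoc],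
      τ.tracial]
    have h2 : r * (b * star b * r) ≤ ‖b‖ ^ 2 • (r * r) := by
      have := CStarAlgebra.star_left_conjugate_le_norm_smul (a := r) (b := b * star b)
        (hb := IsSelfAdjoint.mul_star_self b)
      rw [sr, CStarRing.norm_self_mul_star, ← pow_two] at this
      simpa [mul_assoc] using this
    have h3 := τ.re_mono h2
    have h4 : (τ (‖b‖ ^ 2 • (r * r))).re = ‖b‖ ^ 2 * (τ.norm₁ a + ε) := by
      rw [hrr, ← Complex.coe_smul, map_smul, map_add, Algebra.algebraMap_eq_smul_one,
        ← Complex.coe_smul, map_smul, τ.map_one]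
      rw [smul_eq_mul, Complex.re_ofReal_mul]
      simp [norm₁, ← hdef]
    rw [h4] at h3
    calc _ ≤ √(‖b‖ ^ 2 * (τ.norm₁ a + ε)) := Real.sqrt_le_sqrt h3
      _ = _ := by rw [Real.sqrt_mul (by positivity), Real.sqrt_sq (norm_nonneg b)]

lemma norm₁_nonneg (a : A) : 0 ≤ τ.norm₁ a :=
  (Complex.le_def.1 (τ.toPositiveLinearMap.map_nonneg (CFC.abs_nonneg a))).1

lemma norm_mul_le (a b : A) : ‖τ (a * b)‖ ≤ ‖b‖ * τ.norm₁ a := by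
  have h := τ.norm₁_nonneg a
  have hc : Filter.Tendsto (fun ε : ℝ => √(τ.norm₁ a) * (‖b‖ * √(τ.norm₁ a + ε)))
      (nhdsWithin 0 (Set.Ioi 0)) (nhds (√(τ.norm₁ a) * (‖b‖ * √(τ.norm₁ a + 0)))) :=
    (Continuous.tendsto (by fun_prop) 0).mono_left nhdsWithin_le_nhds
  have := ge_of_tendsto hc (Filter.eventually_of_mem self_mem_nhdsWithin fun ε hε =>
    τ.norm_mul_le_aux a b hε)
  rwa [add_zero, mul_left_comm, Real.mul_self_sqrt h] at this

lemma exists_norm₁_le (a : A) {ε : ℝ} (hε : 0 < ε) :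
    ∃ b : A, ‖b‖ ≤ 1 ∧ τ.norm₁ a ≤ ‖τ (a * b)‖ + ε := by
  set h := CFC.abs a with hdef
  have hh : 0 ≤ h := CFC.abs_nonneg a
  have hpos : ∀ x ∈ spectrum ℝ h, 0 < x + ε := fun x hx => by
    have := spec_nonneg hh hx; linarith
  set q := cfc (fun x : ℝ => (x + ε)⁻¹) h with hq
  have cq : ContinuousOn (fun x : ℝ => (x + ε)⁻¹) (spectrum ℝ h) :=
    ContinuousOn.inv₀ (by fun_prop) fun x hx => (hpos x hx).ne'
  have sq : star q = q := (cfc_predicate (R := ℝ) (p := IsSelfAdjoint) _ h).star_eq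
  have c1 : ContinuousOn (fun x : ℝ => x * x) (spectrum ℝ h) := by fun_prop
  have c2 : ContinuousOn (fun x : ℝ => x) (spectrum ℝ h) := by fun_prop
  have c3 : ContinuousOn (fun x : ℝ => (x + ε)⁻¹ * (x * x)) (spectrum ℝ h) := cq.mul c1
  refine ⟨q * star a, ?_, ?_⟩
  · have hn : ‖q * star a‖ * ‖q * star a‖ ≤ 1 := by
      rw [← CStarRing.norm_self_mul_star, star_mul, star_star, sq,
        show q * star a * (a * q) = q * (star a * a) * q by simp only [mul_assoc],
        ← CFC.abs_mul_abs, ← hdef]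
      have e : q * (h * h) * q = cfc (fun x : ℝ => (x + ε)⁻¹ * (x * x) * (x + ε)⁻¹) h := by
        rw [cfc_mul _ _ h c3 cq, cfc_mul _ _ h cq c1, cfc_mul _ _ h c2 c2, cfc_id' ℝ h]
      rw [e]
      refine norm_cfc_le zero_le_one fun x hx => ?_
      have h0 := spec_nonneg hh hx
      have h1 := hpos x hx
      rw [show (x + ε)⁻¹ * (x * x) * (x + ε)⁻¹ = (x / (x + ε)) ^ 2 by field_simp, norm_pow,
        Real.norm_of_nonneg (by positivity)]
      exact pow_le_one₀ (by positivity) ((div_le_one h1).2 (by linarith))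
    nlinarith [norm_nonneg (q * star a)]
  · rw [τ.tracial, mul_assoc, ← CFC.abs_mul_abs, ← hdef]
    have e : q * (h * h) = cfc (fun x : ℝ => (x + ε)⁻¹ * (x * x)) h := by
      rw [cfc_mul _ _ h cq c1, cfc_mul _ _ h c2 c2, cfc_id' ℝ h]
    have h1 : h ≤ q * (h * h) + algebraMap ℝ A ε := by
      rw [e, ← cfc_add_const ε _ h c3]
      conv_lhs => rw [← cfc_id' ℝ h]
      refine cfc_mono (fun x hx => ?_) c2 (c3.add continuousOn_const)
      have h0 := spec_nonneg hh hx
      have h1 := hpos x hx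
      rw [← sub_nonneg, show (x + ε)⁻¹ * (x * x) + ε - x = ε ^ 2 / (x + ε) by field_simp; ring]
      positivity
    have h2 := τ.re_mono h1
    rw [map_add, Algebra.algebraMap_eq_smul_one, ← Complex.coe_smul, map_smul, τ.map_one] at h2
    simp only [smul_eq_mul, mul_one, Complex.add_re, Complex.ofReal_re] at h2
    exact h2.trans (by gcongr; exact Complex.re_le_norm _)

lemma norm₁_add_le (a c : A) : τ.norm₁ (a + c) ≤ τ.norm₁ a + τ.norm₁ c := by
  refine le_of_forall_pos_le_add fun ε hε => ?_
  obtain ⟨b, hb, h⟩ := τ.exists_norm₁_le (a + c) hε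
  refine h.trans ?_
  gcongr
  rw [add_mul, map_add]
  refine (norm_add_le _ _).trans (add_le_add ?_ ?_)
  · exact (τ.norm_mul_le a b).trans (mul_le_of_le_one_left (τ.norm₁_nonneg a) hb)
  · exact (τ.norm_mul_le c b).trans (mul_le_of_le_one_left (τ.norm₁_nonneg c) hb)

lemma norm₁_smul (z : ℂ) (a : A) : τ.norm₁ (z • a) = ‖z‖ * τ.norm₁ a := by
  rw [norm₁, CFC.abs_smul, ← Complex.coe_smul, map_smul]
  simp [norm₁]

lemma norm₁_eq_zero_iff (a : A) : τ.norm₁ a = 0 ↔ a = 0 := by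
  constructor
  · intro h
    have h0 : 0 ≤ τ (CFC.abs a) := τ.toPositiveLinearMap.map_nonneg (CFC.abs_nonneg a)
    have : τ (CFC.abs a) = 0 := Complex.ext h (Complex.le_def.1 h0).2.symm
    exact CFC.abs_eq_zero_iff.1 (τ.faithful (CFC.abs_nonneg a) this)
  · rintro rfl; simp [norm₁]

lemma norm₁_mul_mul_le (a x b : A) : τ.norm₁ (a * x * b) ≤ ‖a‖ * ‖b‖ * τ.norm₁ x := by
  refine le_of_forall_pos_le_add fun ε hε => ?_
  obtain ⟨c, hc, h⟩ := τ.exists_norm₁_le (a * x * b) hε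
  refine h.trans ?_
  gcongr
  rw [show a * x * b * c = a * (x * (b * c)) by simp only [mul_assoc], τ.tracial,
    mul_assoc]
  refine (τ.norm_mul_le _ _).trans ?_
  gcongr
  · exact τ.norm₁_nonneg x
  calc ‖b * c * a‖ ≤ ‖b‖ * ‖c‖ * ‖a‖ :=
        (_root_.norm_mul_le _ _).trans (by gcongr; exact _root_.norm_mul_le _ _)
    _ ≤ ‖b‖ * 1 * ‖a‖ := by gcongr
    _ = ‖a‖ * ‖b‖ := by ring

end FaithfulTrace

/-! ### The space `L¹(M, τ)` -/

/-- The algebra `A`, to be equipped with the norm `‖·‖₁` in place of its C*-norm. -/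
@[nolint unusedArguments]
def PreLOne (_τ : FaithfulTrace A) : Type _ := A

namespace PreLOne
variable (τ : FaithfulTrace A)

noncomputable instance : AddCommGroup (PreLOne τ) := inferInstanceAs (AddCommGroup A)
noncomputable instance : Module ℂ (PreLOne τ) := inferInstanceAs (Module ℂ A)

/-- The identity map `A → PreLOne τ`. -/
noncomputable def of : A ≃ₗ[ℂ] PreLOne τ := LinearEquiv.refl ℂ A

noncomputable instance : Norm (PreLOne τ) := ⟨fun a => τ.norm₁ ((of τ).symm a)⟩

lemma core : NormedSpace.Core ℂ (PreLOne τ) where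
  norm_nonneg _ := τ.norm₁_nonneg _
  norm_smul z _ := τ.norm₁_smul z _
  norm_triangle _ _ := τ.norm₁_add_le _ _
  norm_eq_zero_iff _ := τ.norm₁_eq_zero_iff _

noncomputable instance : NormedAddCommGroup (PreLOne τ) := NormedAddCommGroup.ofCore (core τ)
noncomputable instance : NormedSpace ℂ (PreLOne τ) := NormedSpace.ofCore (core τ)

lemma norm_of (a : A) : ‖of τ a‖ = τ.norm₁ a := rfl

/-- The functional `a ↦ τ(ab)`. -/
noncomputable def trMul (b : A) : PreLOne τ →L[ℂ] ℂ :=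
  LinearMap.mkContinuous
    (τ.toPositiveLinearMap.toLinearMap ∘ₗ LinearMap.mulRight ℂ b ∘ₗ (of τ).symm.toLinearMap)
    ‖b‖ fun _ => τ.norm_mul_le _ b

/-- The map `x ↦ axb`. -/
noncomputable def conj (a b : A) : PreLOne τ →L[ℂ] PreLOne τ :=
  LinearMap.mkContinuous
    ((of τ).toLinearMap ∘ₗ LinearMap.mulRight ℂ b ∘ₗ LinearMap.mulLeft ℂ a ∘ₗ
      (of τ).symm.toLinearMap)
    (‖a‖ * ‖b‖) fun _ => τ.norm₁_mul_mul_le a _ b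

end PreLOne

/-- `L¹(M, τ)`: the completion of `M` with respect to `‖a‖₁ = τ(|a|)`. -/
abbrev LOne (τ : FaithfulTrace A) : Type _ := UniformSpace.Completion (PreLOne τ)

namespace LOne
variable (τ : FaithfulTrace A)

/-- The inclusion `M ⊂ L¹(M, τ)`. -/
noncomputable def incl : A →ₗ[ℂ] LOne τ :=
  (UniformSpace.Completion.toComplₗᵢ (𝕜 := ℂ) (E := PreLOne τ)).toLinearMap ∘ₗ
    (PreLOne.of τ).toLinearMap

lemma norm_incl (a : A) : ‖incl τ a‖ = (τ (CFC.abs a)).re :=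
  UniformSpace.Completion.norm_coe _

lemma incl_injective : Function.Injective (incl τ) :=
  (UniformSpace.Completion.coe_injective (PreLOne τ)).comp (PreLOne.of τ).injective

lemma denseRange_incl : DenseRange (incl τ) :=
  (UniformSpace.Completion.denseRange_coe (α := PreLOne τ)).comp
    (PreLOne.of τ).surjective.denseRange (UniformSpace.Completion.continuous_coe _)

variable {τ}

/-- The pairing `τ(xb)` of `x ∈ L¹(M, τ)` and `b ∈ M`, extending `τ(ab)` by continuity. In
particular `τ(x) = tr x 1`. -/
noncomputable def tr (x : LOne τ) (b : A) : ℂ := (PreLOne.trMul τ b).fromCompletion x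

lemma tr_incl (a b : A) : tr (incl τ a) b = τ (a * b) :=
  ContinuousLinearMap.fromCompletion_apply_coe _ _

/-- The product `axb ∈ L¹(M, τ)` of `a, b ∈ M` and `x ∈ L¹(M, τ)`, extending the product of `M`
by continuity. -/
noncomputable def conj (a : A) (x : LOne τ) (b : A) : LOne τ := (PreLOne.conj τ a b).completion x

lemma conj_incl (a x b : A) : conj a (incl τ x) b = incl τ (a * x * b) :=
  ContinuousLinearMap.completion_apply_coe _ _

/-- The element of `M` that equals `x`, for `x ∈ L¹(M, τ)` that lies in `M` (and `0` for the other
`x`, where it is not used). -/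
noncomputable def toAlg (x : LOne τ) : A :=
  open Classical in if h : ∃ a, incl τ a = x then h.choose else 0

lemma toAlg_incl (a : A) : toAlg (incl τ a) = a := by
  have h : ∃ b, incl τ b = incl τ a := ⟨a, rfl⟩
  rw [toAlg, dif_pos h]
  exact incl_injective τ h.choose_spec

/-- `x ∈ L¹(M, τ)` is boundedly invertible: it has an inverse `b ∈ M`. -/
def BoundedlyInvertible (x : LOne τ) : Prop :=
  ∃ b : A, conj 1 x b = incl τ 1 ∧ conj b x 1 = incl τ 1

/-- `x ∈ L¹(M, τ)₊`, that is, `τ(xa) ≥ 0` for all `a ∈ M₊`. -/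
def IsPos (x : LOne τ) : Prop := ∀ a : A, 0 ≤ a → 0 ≤ tr x a

/-! ### The normal state space and Hennion's metric -/

variable (τ) in
/-- The normal state space `S = {x ∈ L¹(M, τ)₊ : τ(x) = 1}`. -/
def states : Set (LOne τ) := {x | IsPos x ∧ tr x 1 = 1}

variable (τ) in
/-- `S_b = S ∩ M`, as a set of elements of `M`. -/
def boundedStates : Set A := {b | incl τ b ∈ states τ}

/-- `m(x, y) = max {λ ∈ ℝ : λ y ≤ x}`. -/
noncomputable def mQuantity (x y : LOne τ) : ℝ := sSup {l : ℝ | IsPos (x - (l : ℂ) • y)}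

/-- Hennion's metric `d(x, y) = (1 - m(x, y) m(y, x)) / (1 + m(x, y) m(y, x))`. -/
noncomputable def hennionDist (x y : LOne τ) : ℝ :=
  (1 - mQuantity x y * mQuantity y x) / (1 + mQuantity x y * mQuantity y x)

/-! ### Maps on `L¹(M, τ)` -/

/-- `γ` is positive: it maps `L¹(M, τ)₊` into itself. -/
def PositiveMap (γ : LOne τ → LOne τ) : Prop := ∀ x, IsPos x → IsPos (γ x)

/-- `γ` is faithful: `γ(x) ≠ 0` for all non-zero `x ∈ L¹(M, τ)₊`. -/
def FaithfulMap (γ : LOne τ → LOne τ) : Prop := ∀ x, IsPos x → γ x = 0 → x = 0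

/-- `γ` is `M`-preserving: `γ(M) ⊂ M`. -/
def AlgPreserving (γ : LOne τ → LOne τ) : Prop := ∀ a : A, ∃ b : A, γ (incl τ a) = incl τ b

/-- The projective action `γ · x = γ(x) / τ(γ(x))`. -/
noncomputable def projAct (γ : LOne τ → LOne τ) (x : LOne τ) : LOne τ := (tr (γ x) 1)⁻¹ • γ x

/-- The Hennion contraction constant
`c(γ) = sup {d(γ · x, γ · y) / d(x, y) : x, y ∈ S, x ≠ y}` of a faithful positive linear map. -/
noncomputable def hennionConst (γ : LOne τ → LOne τ) : ℝ :=
  sSup {r | ∃ x ∈ states τ, ∃ y ∈ states τ, x ≠ y ∧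
    r = hennionDist (projAct γ x) (projAct γ y) / hennionDist x y}

variable (τ) in
/-- `SHC(M)`: the strict Hennion contractions, i.e. the faithful positive linear maps `γ` on
`L¹(M, τ)` with `c(γ) < 1`. -/
def SHC : Set (LOne τ → LOne τ) :=
  {γ | IsLinearMap ℂ γ ∧ PositiveMap γ ∧ FaithfulMap γ ∧ hennionConst γ < 1}

/-- The dual map `γ* : M → M` of a bounded linear map `γ` on `L¹(M, τ)`: `γ*(a)` is the element of
`M` with `τ(γ(x) a) = τ(x γ*(a))` for all `x ∈ L¹(M, τ)`. -/
noncomputable def dual (γ : LOne τ → LOne τ) (a : A) : A :=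
  open Classical in if h : ∃ c : A, ∀ x : LOne τ, tr (γ x) a = tr x c then h.choose else 0

lemma eq_of_tr_eq {c c' : A} (h : ∀ x : LOne τ, tr x c = tr x c') : c = c' := by
  have h1 := h (incl τ (star (c - c')))
  rw [tr_incl, tr_incl, ← sub_eq_zero, ← map_sub, ← mul_sub] at h1
  have h2 := τ.faithful (star_mul_self_nonneg (c - c')) h1
  exact sub_eq_zero.1 (CStarRing.star_mul_self_eq_zero_iff _ |>.1 h2)

lemma dual_eq {γ : LOne τ → LOne τ} {a c : A} (h : ∀ x : LOne τ, tr (γ x) a = tr x c) :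
    dual γ a = c := by
  have h' : ∃ c : A, ∀ x : LOne τ, tr (γ x) a = tr x c := ⟨c, h⟩
  rw [dual, dif_pos h']
  exact eq_of_tr_eq fun x => (h'.choose_spec x).symm.trans (h x)

/-- The projective action `γ* · b = γ*(b) / τ(γ*(b))` of the dual map. -/
noncomputable def dualProjAct (γ : LOne τ → LOne τ) (b : A) : A := (τ (dual γ b))⁻¹ • dual γ b

end LOne
end tr

/-! ### Random linear operators and quantum processes -/

section random
open MeasureTheory

variable {Ω : Type*} [MeasurableSpace Ω]

/-- A bounded random linear operator on the Banach space `X`: for every `x`, `ω ↦ γ_ω(x)` is an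
almost sure limit of simple functions, and almost surely `γ_ω` is a bounded linear map. -/
structure IsBoundedRandomLinearOperator {X : Type*} [NormedAddCommGroup X] [NormedSpace ℂ X]
    (P : Measure Ω) (γ : Ω → X → X) : Prop where
  aestronglyMeasurable : ∀ x, AEStronglyMeasurable (fun ω => γ ω x) P
  isBoundedLinearMap : ∀ᵐ ω ∂P, IsBoundedLinearMap ℂ (γ ω)

/-- `T^k ω` for `k ∈ ℤ`. -/
def iter (T : Ω ≃ᵐ Ω) (k : ℤ) (ω : Ω) : Ω := ((T.toEquiv : Equiv.Perm Ω) ^ k) ω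

/-- `γ_{T^{m+k} ω} ∘ ⋯ ∘ γ_{T^m ω}`. -/
def processAux {X : Type*} (T : Ω ≃ᵐ Ω) (γ : Ω → X → X) (m : ℤ) : ℕ → Ω → X → X
  | 0, ω => γ (iter T m ω)
  | k + 1, ω => γ (iter T (m + (k + 1 : ℕ)) ω) ∘ processAux T γ m k ω

/-- The quantum process `Γ_{n,m}(ω) = γ_{T^n ω} ∘ γ_{T^{n-1} ω} ∘ ⋯ ∘ γ_{T^m ω}`, for `m ≤ n`. -/
def process {X : Type*} (T : Ω ≃ᵐ Ω) (γ : Ω → X → X) (n m : ℤ) (ω : Ω) : X → X :=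
  processAux T γ m (n - m).toNat ω

end random

section normalized
variable {A : Type*} [CStarAlgebra A] [PartialOrder A] [StarOrderedRing A] {τ : FaithfulTrace A}

/-- `Γ(1)^{-1/2} ∈ M`, for a map `Γ` on `L¹(M, τ)` such that `Γ(1) ∈ M` is positive and
invertible. -/
noncomputable def invSqrtOne (Γ : LOne τ → LOne τ) : A :=
  (LOne.toAlg (Γ (LOne.incl τ 1))) ^ (-(1 / 2) : ℝ)

/-- `Γ(1)^{-1} ∈ M`, for a map `Γ` on `L¹(M, τ)` such that `Γ(1) ∈ M` is invertible. -/
noncomputable def invOne (Γ : LOne τ → LOne τ) : A := Ring.inverse (LOne.toAlg (Γ (LOne.incl τ 1)))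

end normalized
end EQP

open EQP MeasureTheory Filter Topology

open scoped ComplexOrder
open EQP MeasureTheory Filter Topology

/-! Fix m and write Γ for Γ_{n,m}. For self-adjoint a, a bracket is a pair α ≤ β with α Γ(1) ≤ Γ(a)
≤ β Γ(1). Positivity keeps a bracket valid under all later maps, so it suffices to shrink it
infinitely often by a fixed factor.

A strict Hennion contraction γ does this. Since d ≤ 1, both d(γ·x, γ·y) ≤ c and m ≤ 1 give m(γ·y,
γ·x) ≥ (1 - c)/(1 + c), which is a Harnack inequality κ (γ·x) ≤ γ·y
(`exists_harnackWith_of_mem_SHC`). Applied to Γ(a) - α Γ(1) and β Γ(1) - Γ(a), it shortens the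
bracket by the factor 1 - κ (`IsContracting.exists_squeeze`). The Harnack inequality is a measurable
event, and block lengths and constants 1/(j+1) form a countable family. One choice therefore has
positive probability, and ergodicity makes it recur along almost every forward orbit
(`exists_ae_frequently_harnackWith`).

Hence τ(Γ(a))/τ(Γ(1)) converges to some φ(a), and conjugating the brackets by Γ(1)^{-1/2} gives
convergence in operator norm (`IsContracting.tendsto_conj_of_tendsto_ratio`). A single Harnack block
also yields φ ≤ Cτ, so a bounded Radon–Nikodym theorem (`FaithfulTrace.exists_density`) writes φ =
τ(· b) with b in M; this b is B_m. The same theorem produces dual maps. Equivariance of B follows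
from uniqueness of the limit, measurability from a Pettis argument, and the ‖·‖₁ statement from
density of M together with the uniform bound `IsRegular.norm_conj_invSqrtOne_le`. -/

namespace EQP
set_option linter.unusedSectionVars false

/-! ### Trace, pairing and positive cone of L¹(M, τ). -/

section tr
variable {A : Type*} [CStarAlgebra A] [PartialOrder A] [StarOrderedRing A]

namespace FaithfulTrace
variable (τ : FaithfulTrace A)

protected lemma map_nonneg {a : A} (ha : 0 ≤ a) : 0 ≤ τ a := τ.toPositiveLinearMap.map_nonneg ha

lemma ofReal_re {a : A} (ha : 0 ≤ a) : ((τ a).re : ℂ) = τ a :=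
  (Complex.eq_re_of_ofReal_le (r := 0) (by simpa using τ.map_nonneg ha)).symm

lemma norm₁_of_nonneg {a : A} (ha : 0 ≤ a) : τ.norm₁ a = (τ a).re := by
  rw [norm₁, CFC.abs_of_nonneg a ha]

/-- By traciality, τ(ab) = τ(√a b √a). -/
lemma map_mul_nonneg {a b : A} (ha : 0 ≤ a) (hb : 0 ≤ b) : 0 ≤ τ (a * b) := by
  have h1 := CFC.sqrt_mul_sqrt_self a ha
  have h2 : star (CFC.sqrt a) = CFC.sqrt a := (CFC.sqrt_nonneg a).isSelfAdjoint.star_eq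
  rw [← h1, mul_assoc, τ.tracial]
  have := star_left_conjugate_nonneg hb (CFC.sqrt a)
  rw [h2] at this
  exact τ.map_nonneg this

protected lemma map_star (a : A) : τ (star a) = star (τ a) := StarHomClass.map_star τ.toPositiveLinearMap a

protected lemma map_smul (z : ℂ) (a : A) : τ (z • a) = z * τ a := _root_.map_smul τ.toPositiveLinearMap z a

protected lemma map_add (a b : A) : τ (a + b) = τ a + τ b := _root_.map_add τ.toPositiveLinearMap a b

protected lemma map_sub (a b : A) : τ (a - b) = τ a - τ b := _root_.map_sub τ.toPositiveLinearMap a b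

protected lemma map_zero : τ 0 = 0 := _root_.map_zero τ.toPositiveLinearMap

lemma eq_zero_of_map_mul {a : A} (h : ∀ b, τ (a * b) = 0) : a = 0 := by
  have h1 := h (star a)
  have := τ.faithful (mul_star_self_nonneg a) h1
  exact CStarRing.mul_star_self_eq_zero_iff _ |>.1 this

/-- A linear functional that vanishes on the positive cone is zero. -/
lemma _root_.EQP.linearMap_ext_nonneg {V : Type*} [AddCommGroup V] [Module ℂ V]
    {f g : A →ₗ[ℂ] V} (h : ∀ a, 0 ≤ a → f a = g a) : f = g := by
  have hsa : ∀ a, IsSelfAdjoint a → f a = g a := by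
    intro a ha
    rw [← CFC.posPart_sub_negPart a ha, _root_.map_sub, _root_.map_sub,
      h _ (CFC.posPart_nonneg a), h _ (CFC.negPart_nonneg a)]
  ext a
  rw [← realPart_add_I_smul_imaginaryPart a]
  simp only [_root_.map_add, _root_.map_smul]
  rw [hsa _ (realPart a).2, hsa _ (imaginaryPart a).2]

/-- Reality of the pairing on positive b forces a to be self-adjoint. Testing with b = a⁻ then gives
τ(a a⁻) = -τ((a⁻)²) ≥ 0, so a⁻ = 0 by faithfulness. -/
lemma nonneg_of_map_mul_nonneg {a : A} (h : ∀ b, 0 ≤ b → 0 ≤ τ (a * b)) : 0 ≤ a := by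
  have hsa : IsSelfAdjoint a := by
    have : ∀ b, τ ((star a - a) * b) = 0 := by
      have e := linearMap_ext_nonneg
        (f := τ.toPositiveLinearMap.toLinearMap ∘ₗ LinearMap.mulLeft ℂ (star a - a)) (g := 0)
        (fun b hb => by
          change τ ((star a - a) * b) = 0
          have h1 : τ (star a * b) = star (τ (a * b)) := by
            rw [← τ.map_star, star_mul, τ.tracial, hb.isSelfAdjoint.star_eq]
          have h2 : star (τ (a * b)) = τ (a * b) := (h b hb).isSelfAdjoint.star_eq
          rw [sub_mul, τ.map_sub, h1, h2, sub_self])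
      exact fun b => LinearMap.congr_fun e b
    exact sub_eq_zero.1 (τ.eq_zero_of_map_mul this)
  have h1 := h _ (CFC.negPart_nonneg a)
  have h2 : a * a⁻ = -(star a⁻ * a⁻) := by
    conv_lhs => enter [1]; rw [← CFC.posPart_sub_negPart a hsa]
    rw [sub_mul, CFC.posPart_mul_negPart, (CFC.negPart_nonneg a).isSelfAdjoint.star_eq, zero_sub]
  have h3 : τ (star a⁻ * a⁻) = 0 := by
    refine le_antisymm ?_ (τ.map_nonneg (star_mul_self_nonneg _))
    rw [h2, _root_.map_neg] at h1
    exact neg_nonneg.1 h1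
  have h4 := CStarRing.star_mul_self_eq_zero_iff _ |>.1
    (τ.faithful (star_mul_self_nonneg _) h3)
  exact (CFC.negPart_eq_zero_iff a hsa).1 h4

end FaithfulTrace

namespace LOne
variable {τ : FaithfulTrace A}

/-- The pairing with `b ∈ M`, as a continuous linear functional on `L¹(M, τ)`. -/
noncomputable def trL (b : A) : LOne τ →L[ℂ] ℂ := (PreLOne.trMul τ b).fromCompletion


/-- The map `x ↦ axb`, as a continuous linear map on `L¹(M, τ)`. -/
noncomputable def conjL (a b : A) : LOne τ →L[ℂ] LOne τ := (PreLOne.conj τ a b).completion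

lemma conjL_apply (a b : A) (x : LOne τ) : conjL a b x = conj a x b := rfl

lemma tr_add (x y : LOne τ) (b : A) : tr (x + y) b = tr x b + tr y b := map_add (trL b) x y
lemma tr_sub (x y : LOne τ) (b : A) : tr (x - y) b = tr x b - tr y b := map_sub (trL b) x y
lemma tr_smul (z : ℂ) (x : LOne τ) (b : A) : tr (z • x) b = z * tr x b := map_smul (trL b) z x
lemma tr_zero (b : A) : tr (0 : LOne τ) b = 0 := map_zero (trL b)
lemma continuous_tr (b : A) : Continuous fun x : LOne τ => tr x b := (trL b).continuous
lemma continuous_conj (a b : A) : Continuous fun x : LOne τ => conj a x b := (conjL a b).continuous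

lemma induction_incl {p : LOne τ → Prop} (x : LOne τ) (hc : IsClosed {x | p x})
    (h : ∀ a, p (incl τ a)) : p x :=
  (denseRange_incl τ).induction_on x hc h

lemma norm_incl_eq (a : A) : ‖incl τ a‖ = τ.norm₁ a := norm_incl τ a

lemma norm_tr_le (x : LOne τ) (b : A) : ‖tr x b‖ ≤ ‖b‖ * ‖x‖ := by
  refine induction_incl x (isClosed_le (continuous_tr b).norm (continuous_const.mul continuous_norm)) fun a => ?_
  rw [Pi.mul_apply, tr_incl, norm_incl_eq]
  exact τ.norm_mul_le a b

lemma tr_add_right (x : LOne τ) (b c : A) : tr x (b + c) = tr x b + tr x c := by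
  refine induction_incl x
    (isClosed_eq (continuous_tr _) ((continuous_tr b).add (continuous_tr c))) fun a => ?_
  simp only [Pi.add_apply, tr_incl, mul_add, τ.map_add]

lemma tr_smul_right (z : ℂ) (x : LOne τ) (b : A) : tr x (z • b) = z * tr x b := by
  refine induction_incl x
    (isClosed_eq (continuous_tr _) (continuous_const.mul (continuous_tr b))) fun a => ?_
  simp only [Pi.mul_apply, tr_incl, mul_smul_comm, τ.map_smul]

/-- The pairing with `x ∈ L¹(M, τ)`, as a linear functional on `M`. -/
noncomputable def trRight (x : LOne τ) : A →ₗ[ℂ] ℂ where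
  toFun := tr x
  map_add' := tr_add_right x
  map_smul' z b := tr_smul_right z x b

/-- Replacing x by a nearby element of M moves both the norm and the pairing with a contraction by
less than ε/3, so a nearly norming contraction for the approximant serves x as well. -/
lemma exists_norm_le (x : LOne τ) {ε : ℝ} (hε : 0 < ε) :
    ∃ b : A, ‖b‖ ≤ 1 ∧ ‖x‖ ≤ ‖tr x b‖ + ε := by
  obtain ⟨a, ha⟩ := (denseRange_incl τ).exists_dist_lt x (show 0 < ε / 3 by linarith)
  obtain ⟨b, hb, h⟩ := τ.exists_norm₁_le a (show 0 < ε / 3 by linarith)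
  refine ⟨b, hb, ?_⟩
  rw [dist_eq_norm] at ha
  have h1 : ‖x‖ ≤ ‖x - incl τ a‖ + ‖incl τ a‖ := by simpa using norm_add_le (x - incl τ a) (incl τ a)
  have h2 : ‖tr (x - incl τ a) b‖ ≤ ‖x - incl τ a‖ :=
    (norm_tr_le _ _).trans (mul_le_of_le_one_left (norm_nonneg _) hb)
  rw [tr_sub, tr_incl] at h2
  have h3 := norm_sub_norm_le (τ (a * b)) (tr x b)
  rw [norm_sub_rev] at h3
  rw [norm_incl_eq] at h1
  linarith

lemma eq_zero_of_tr {x : LOne τ} (h : ∀ b, tr x b = 0) : x = 0 := by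
  rw [← norm_le_zero_iff]
  refine le_of_forall_pos_le_add fun ε hε => ?_
  obtain ⟨b, -, hb⟩ := exists_norm_le x hε
  simpa [h b] using hb


lemma norm_incl_le (a : A) : ‖incl τ a‖ ≤ ‖a‖ := by
  obtain h := fun (ε : ℝ) (hε : 0 < ε) => τ.exists_norm₁_le a hε
  rw [norm_incl_eq]
  refine le_of_forall_pos_le_add fun ε hε => ?_
  obtain ⟨b, hb, h1⟩ := h ε hε
  have h2 := τ.norm_mul_le 1 (a * b)
  have h3 : τ.norm₁ (1 : A) = 1 := by
    rw [τ.norm₁_of_nonneg zero_le_one, τ.map_one, Complex.one_re]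
  rw [one_mul, h3, mul_one] at h2
  have : ‖a * b‖ ≤ ‖a‖ := (norm_mul_le _ _).trans (mul_le_of_le_one_right (norm_nonneg _) hb)
  linarith

/-! ### The positive cone -/

lemma isClosed_isPos : IsClosed {x : LOne τ | IsPos x} := by
  simp only [IsPos, Set.ofPred_forall]
  exact isClosed_iInter fun a => isClosed_iInter fun _ =>
    isClosed_le continuous_const (continuous_tr a)

lemma isPos_incl_iff {a : A} : IsPos (incl τ a) ↔ 0 ≤ a := by
  simp only [IsPos, tr_incl]
  exact ⟨τ.nonneg_of_map_mul_nonneg, fun h b hb => τ.map_mul_nonneg h hb⟩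

lemma IsPos.zero : IsPos (0 : LOne τ) := fun a _ => (tr_zero a).ge

lemma IsPos.add {x y : LOne τ} (hx : IsPos x) (hy : IsPos y) : IsPos (x + y) := fun a ha => by
  rw [tr_add]; exact add_nonneg (hx a ha) (hy a ha)

lemma IsPos.smul {x : LOne τ} (hx : IsPos x) {z : ℂ} (hz : 0 ≤ z) : IsPos (z • x) :=
  fun a ha => by rw [tr_smul]; exact mul_nonneg hz (hx a ha)

lemma IsPos.tr_nonneg {x : LOne τ} (hx : IsPos x) : 0 ≤ tr x 1 := hx 1 zero_le_one

/-- From 0 ≤ a ≤ ‖a‖1, positivity traps `tr x a` between 0 and ‖a‖ `tr x 1`. -/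
lemma IsPos.eq_zero {x : LOne τ} (hx : IsPos x) (h : tr x 1 = 0) : x = 0 := by
  refine eq_zero_of_tr fun b => ?_
  refine LinearMap.congr_fun (linearMap_ext_nonneg (f := trRight x) (g := 0) fun a ha => ?_) b
  have h1 : 0 ≤ tr x ((‖a‖ : ℂ) • (1 : A) - a) := hx _ (by
    rw [Complex.coe_smul, ← Algebra.algebraMap_eq_smul_one]
    exact sub_nonneg.2 ha.isSelfAdjoint.le_algebraMap_norm_self)
  have h2 : tr x ((‖a‖ : ℂ) • (1 : A) - a) = - tr x a := by
    have := map_sub (trRight x) ((‖a‖ : ℂ) • (1 : A)) a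
    change tr x _ = tr x _ - tr x _ at this
    rw [this, tr_smul_right, h, mul_zero, zero_sub]
  rw [h2] at h1
  exact le_antisymm (neg_nonneg.1 h1) (hx a ha)

lemma IsPos.tr_pos {x : LOne τ} (hx : IsPos x) (h : x ≠ 0) : 0 < tr x 1 :=
  lt_of_le_of_ne hx.tr_nonneg fun h0 => h (hx.eq_zero h0.symm)

end LOne
end tr

/-! ### Weak compactness and a bounded Radon–Nikodym theorem. -/

section Riesz
variable {H : Type*} [NormedAddCommGroup H] [InnerProductSpace ℂ H] [CompleteSpace H]

/-- A bounded family of operators has a weak limit along every ultrafilter. -/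
lemma exists_weak_limit {ι : Type*} (u : Ultrafilter ι) (x : ι → H →L[ℂ] H) (C : ℝ)
    (hx : ∀ i, ‖x i‖ ≤ C) :
    ∃ b : H →L[ℂ] H, ∀ v w : H, Tendsto (fun i => inner ℂ w (x i v)) u (𝓝 (inner ℂ w (b v))) := by
  have hb : ∀ v w i, ‖inner ℂ (x i v) w‖ ≤ C * ‖v‖ * ‖w‖ := fun v w i =>
    (norm_inner_le_norm _ _).trans (by
      gcongr; exact ((x i).le_opNorm v).trans (by gcongr; exact hx i))
  have hl : ∀ v w, ∃ l : ℂ, ‖l‖ ≤ C * ‖v‖ * ‖w‖ ∧ Tendsto (fun i => inner ℂ (x i v) w) u (𝓝 l) := by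
    intro v w
    obtain ⟨l, hl, h⟩ := (isCompact_closedBall (0 : ℂ) (C * ‖v‖ * ‖w‖)).ultrafilter_le_nhds
      (u.map fun i => inner ℂ (x i v) w) (by
        rw [le_principal_iff]
        exact mem_map.2 (univ_mem' fun i => by simpa using hb v w i))
    exact ⟨l, by simpa using hl, h⟩
  choose l hl ht using hl
  have eq := fun {v w : H} {z : ℂ} (h : Tendsto (fun i => inner ℂ (x i v) w) u (𝓝 z)) =>
    tendsto_nhds_unique (ht v w) h
  -- Uniqueness of limits makes l sesquilinear, and the bound C‖v‖‖w‖ survives the limit, so the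
  -- Riesz representation turns l into a bounded operator.
  let B : H →ₗ⋆[ℂ] H →ₗ[ℂ] ℂ := LinearMap.mk₂'ₛₗ (starRingEnd ℂ) (RingHom.id ℂ) l
    (fun v v' w => eq (by simpa [inner_add_left] using (ht v w).add (ht v' w)))
    (fun c v w => eq (by simpa [inner_smul_left, mul_comm] using (ht v w).const_mul (starRingEnd ℂ c)))
    (fun v w w' => eq (by simpa [inner_add_right] using (ht v w).add (ht v w')))
    (fun c v w => eq (by simpa [inner_smul_right] using (ht v w).const_mul c))
  let Bc : H →L⋆[ℂ] H →L[ℂ] ℂ := LinearMap.mkContinuous₂ B C hl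
  refine ⟨InnerProductSpace.continuousLinearMapOfBilin Bc, fun v w => ?_⟩
  have h : inner ℂ (InnerProductSpace.continuousLinearMapOfBilin Bc v) w = l v w :=
    InnerProductSpace.continuousLinearMapOfBilin_apply Bc v w
  have h1 := (continuous_star.tendsto _).comp (ht v w)
  rw [← h] at h1
  rw [← inner_conj_symm w]
  exact h1.congr fun i => inner_conj_symm _ _

variable (M : VonNeumannAlgebra H)

/-- Commutation with a fixed z passes to weak limits, because z moves across the inner product as
its adjoint; M is the commutant of its commutant. -/
lemma mem_of_weak_limit {ι : Type*} {u : Filter ι} [u.NeBot] {x : ι → H →L[ℂ] H}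
    (hx : ∀ i, x i ∈ M) {b : H →L[ℂ] H}
    (h : ∀ v w : H, Tendsto (fun i => inner ℂ w (x i v)) u (𝓝 (inner ℂ w (b v)))) : b ∈ M := by
  rw [← SetLike.mem_coe, ← M.centralizer_centralizer]
  intro z hz
  ext v
  refine ext_inner_left ℂ fun w => ?_
  have h1 := h v (ContinuousLinearMap.adjoint z w)
  have h2 := h (z v) w
  simp only [ContinuousLinearMap.adjoint_inner_left] at h1
  refine tendsto_nhds_unique h1 (h2.congr fun i => ?_)
  have : x i * z = z * x i := hz _ (hx i)
  change inner ℂ w ((x i * z) v) = _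
  rw [this]; rfl

variable {M}

/-- A bounded family in `M` has a limit along every ultrafilter, in the duality with normal
functionals `a ↦ φ(ab)`. -/
lemma IsNormal.exists_limit {φ : M → ℂ} (hφ : IsNormal M φ) {ι : Type*} (u : Ultrafilter ι)
    (x : ι → M) (C : ℝ) (hx : ∀ i, ‖x i‖ ≤ C) :
    ∃ b : M, ∀ a : M, Tendsto (fun i => φ (a * x i)) u (𝓝 (φ (a * b))) := by
  obtain ⟨b, hb⟩ := exists_weak_limit u (fun i => (x i : H →L[ℂ] H)) C hx
  refine ⟨⟨b, mem_of_weak_limit M (fun i => (x i).2) hb⟩, fun a => ?_⟩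
  obtain ⟨ξ, η, hξ, hη, h⟩ := hφ
  have e : ∀ y : M, φ (a * y) =
      ∑' n, inner ℂ (ContinuousLinearMap.adjoint (a : H →L[ℂ] H) (η n)) ((y : H →L[ℂ] H) (ξ n)) := by
    intro y
    rw [← (h (a * y)).tsum_eq]
    simp only [ContinuousLinearMap.adjoint_inner_left]
    rfl
  simp only [e]
  -- Each term converges by weak convergence, and ‖ξ n‖‖η n‖ ≤ ‖ξ n‖² + ‖η n‖² supplies a summable
  -- majorant.
  refine tendsto_tsum_of_dominated_convergence
    (bound := fun n => ‖(a : H →L[ℂ] H)‖ * C * (‖ξ n‖ ^ 2 + ‖η n‖ ^ 2))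
    ((hξ.add hη).mul_left _) (fun n => hb _ _) (Eventually.of_forall fun i n => ?_)
  have h1 : ‖ContinuousLinearMap.adjoint (a : H →L[ℂ] H) (η n)‖ ≤ ‖(a : H →L[ℂ] H)‖ * ‖η n‖ :=
    (ContinuousLinearMap.le_opNorm _ _).trans_eq (by rw [LinearIsometryEquiv.norm_map])
  have h2 : ‖(x i : H →L[ℂ] H) (ξ n)‖ ≤ C * ‖ξ n‖ :=
    ((x i : H →L[ℂ] H).le_opNorm _).trans (by gcongr; exact hx i)
  have hC : 0 ≤ C := (norm_nonneg _).trans (hx i)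
  calc _ ≤ _ := norm_inner_le_norm _ _
    _ ≤ ‖(a : H →L[ℂ] H)‖ * ‖η n‖ * (C * ‖ξ n‖) := by gcongr
    _ = ‖(a : H →L[ℂ] H)‖ * C * (‖ξ n‖ * ‖η n‖) := by ring
    _ ≤ _ := by gcongr; nlinarith [sq_nonneg (‖ξ n‖ - ‖η n‖), sq_nonneg ‖ξ n‖, sq_nonneg ‖η n‖]

/-- An almost optimal contraction for the positive part: `τ(a⁺) ≤ τ(ac) + ε` with `0 ≤ c ≤ 1`. -/
lemma FaithfulTrace.exists_posPart_le {A : Type*} [CStarAlgebra A] [PartialOrder A]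
    [StarOrderedRing A] (τ : FaithfulTrace A) {a : A} (ha : IsSelfAdjoint a) {ε : ℝ} (hε : 0 < ε) :
    ∃ c : A, 0 ≤ c ∧ c ≤ 1 ∧ (τ a⁺).re ≤ (τ (a * c)).re + ε := by
  have hpos : ∀ x : ℝ, 0 < x⁺ + ε := fun x => add_pos_of_nonneg_of_pos (posPart_nonneg x) hε
  have cp : Continuous fun x : ℝ => x⁺ := by simp only [posPart_def]; fun_prop
  have cc : Continuous fun x : ℝ => x⁺ * (x⁺ + ε)⁻¹ :=
    cp.mul ((cp.add continuous_const).inv₀ fun x => (hpos x).ne')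
  -- The continuous function x⁺/(x⁺ + ε) replaces the spectral projection onto the positive part;
  -- the error x⁺ - x·x⁺/(x⁺ + ε) is at most ε.
  refine ⟨cfc (fun x : ℝ => x⁺ * (x⁺ + ε)⁻¹) a, cfc_nonneg fun x _ => ?_, cfc_le_one _ _ fun x _ => ?_, ?_⟩
  · exact mul_nonneg (posPart_nonneg x) (inv_nonneg.2 (hpos x).le)
  · rw [← div_eq_mul_inv, div_le_one (hpos x)]; linarith
  · have e : a * cfc (fun x : ℝ => x⁺ * (x⁺ + ε)⁻¹) a =
        cfc (fun x : ℝ => x * (x⁺ * (x⁺ + ε)⁻¹)) a := by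
      rw [cfc_mul (fun x : ℝ => x) _ a continuousOn_id cc.continuousOn, cfc_id' ℝ a]
    have h1 : a⁺ ≤ a * cfc (fun x : ℝ => x⁺ * (x⁺ + ε)⁻¹) a + algebraMap ℝ A ε := by
      rw [e, ← cfc_add_const ε (fun x : ℝ => x * (x⁺ * (x⁺ + ε)⁻¹)) a (continuous_id.mul cc).continuousOn, CFC.posPart_def, cfcₙ_eq_cfc (hf0 := by simp)]
      refine cfc_mono (fun x _ => ?_) cp.continuousOn
        ((continuous_id.mul cc).add continuous_const).continuousOn
      have h2 : x * x⁺ = x⁺ * x⁺ := by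
        rcases le_total 0 x with h | h
        · rw [posPart_eq_self.2 h]
        · rw [posPart_eq_zero.2 h]; simp
      have h3 := hpos x
      have h4 : x * (x⁺ * (x⁺ + ε)⁻¹) = x⁺ * x⁺ / (x⁺ + ε) := by
        rw [← mul_assoc, h2, div_eq_mul_inv]
      rw [h4, ← sub_nonneg,
        show x⁺ * x⁺ / (x⁺ + ε) + ε - x⁺ = ε ^ 2 / (x⁺ + ε) by field_simp; ring]
      positivity
    have h2 := τ.re_mono h1
    rw [τ.map_add, Algebra.algebraMap_eq_smul_one, ← Complex.coe_smul, τ.map_smul, τ.map_one] at h2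
    simpa using h2

/-- A positive functional on a C*-algebra takes real values on self-adjoint elements. -/
lemma im_eq_zero_of_nonneg {A : Type*} [CStarAlgebra A] [PartialOrder A]
    [StarOrderedRing A] (ψ : A →ₗ[ℂ] ℂ) (hψ : ∀ c, 0 ≤ c → 0 ≤ ψ c) (c : A) (hc : IsSelfAdjoint c) :
    (ψ c).im = 0 := by
  have h1 := (Complex.le_def.1 (hψ _ (CFC.posPart_nonneg c))).2
  have h2 := (Complex.le_def.1 (hψ _ (CFC.negPart_nonneg c))).2
  rw [← CFC.posPart_sub_negPart c hc, map_sub, Complex.sub_im, ← h1, ← h2, sub_self]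

/-- The real part of a positive functional only depends on the real part of its argument. -/
lemma re_eq_re_realPart {A : Type*} [CStarAlgebra A] [PartialOrder A]
    [StarOrderedRing A] (ψ : A →ₗ[ℂ] ℂ) (hψ : ∀ c, 0 ≤ c → 0 ≤ ψ c) (a : A) :
    (ψ a).re = (ψ (realPart a : A)).re := by
  have := im_eq_zero_of_nonneg ψ hψ _ (imaginaryPart a).2
  conv_lhs => rw [← realPart_add_I_smul_imaginaryPart a]
  rw [map_add, map_smul]
  simp [this]

/-- If a positive functional `φ` satisfies `φ ≤ Cτ`, then `Re φ(a)` is at most the supremum of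
`Re τ(ab)` over `0 ≤ b ≤ C`. -/
lemma FaithfulTrace.re_map_le_of_forall_le {A : Type*} [CStarAlgebra A] [PartialOrder A]
    [StarOrderedRing A] (τ : FaithfulTrace A) (φ : A →ₗ[ℂ] ℂ) (hφ : ∀ a, 0 ≤ a → 0 ≤ φ a) {C : ℝ}
    (hC0 : 0 ≤ C) (hC : ∀ a, 0 ≤ a → (φ a).re ≤ C * (τ a).re) (a : A) {s : ℝ}
    (hs : ∀ b, 0 ≤ b → b ≤ algebraMap ℝ A C → (τ (a * b)).re ≤ s) : (φ a).re ≤ s := by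
  rw [re_eq_re_realPart φ hφ]
  set r : A := (realPart a : A) with hr
  have hrs : IsSelfAdjoint r := (realPart a).2
  have h1 : (φ r).re ≤ C * (τ r⁺).re := by
    refine le_trans ?_ (hC _ (CFC.posPart_nonneg r))
    conv_lhs => rw [← CFC.posPart_sub_negPart r hrs]
    rw [_root_.map_sub, Complex.sub_re]
    have := (Complex.le_def.1 (hφ _ (CFC.negPart_nonneg r))).1
    simp only [Complex.zero_re] at this
    linarith
  refine h1.trans (le_of_forall_pos_le_add fun ε hε => ?_)
  -- The test element will be C c. Dividing ε by C + 1 instead of C also covers C = 0.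
  obtain ⟨c, hc0, hc1, hc⟩ := τ.exists_posPart_le hrs (ε := ε / (C + 1)) (by positivity)
  have hcC : 0 ≤ C • c := smul_nonneg hC0 hc0
  have h3 := hs (C • c) hcC (by
    rw [Algebra.algebraMap_eq_smul_one]; gcongr)
  have h4 := re_eq_re_realPart (τ.toPositiveLinearMap.toLinearMap ∘ₗ LinearMap.mulRight ℂ (C • c))
    (fun d hd => τ.map_mul_nonneg hd hcC) a
  change (τ (a * (C • c))).re = (τ (r * (C • c))).re at h4
  rw [h4, mul_smul_comm, ← Complex.coe_smul, τ.map_smul, Complex.re_ofReal_mul] at h3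
  have h5 : C * (ε / (C + 1)) ≤ ε := by
    rw [mul_div_assoc', div_le_iff₀ (by positivity)]; nlinarith
  calc _ ≤ C * ((τ (r * c)).re + ε / (C + 1)) := mul_le_mul_of_nonneg_left hc hC0
    _ = C * (τ (r * c)).re + C * (ε / (C + 1)) := mul_add _ _ _
    _ ≤ s + ε := add_le_add h3 h5

/-- A positive functional dominated by a multiple of a normal faithful trace `τ` is `τ(· b)`. -/
theorem FaithfulTrace.exists_density (τ : FaithfulTrace M) (hτ : IsNormal M τ) (φ : M →ₗ[ℂ] ℂ)
    (hφ : ∀ a, 0 ≤ a → 0 ≤ φ a) {C : ℝ} (hC : ∀ a, 0 ≤ a → (φ a).re ≤ C * (τ a).re) :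
    ∃ b : M, 0 ≤ b ∧ ∀ a, φ a = τ (a * b) := by
  have hC0 : 0 ≤ C := by
    have := hC 1 zero_le_one
    rw [τ.map_one, Complex.one_re, mul_one] at this
    exact (Complex.le_def.1 (hφ 1 zero_le_one)).1.trans this
  have hCM : 0 ≤ algebraMap ℝ M C := by
    rw [Algebra.algebraMap_eq_smul_one]
    exact smul_nonneg hC0 zero_le_one
  -- This pairing gives the algebraic dual the topology of pointwise convergence on M, whose
  -- continuous functionals are the evaluations at elements of M. Hahn–Banach separation then takes
  -- place at a single a.
  let B : (M →ₗ[ℂ] ℂ) →ₗ[ℂ] M →ₗ[ℂ] ℂ := LinearMap.id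
  let D : M → WeakBilin B := fun b =>
    (τ.toPositiveLinearMap.toLinearMap ∘ₗ LinearMap.mulRight ℂ b : M →ₗ[ℂ] ℂ)
  have D_apply : ∀ a b, B (D b) a = τ (a * b) := fun _ _ => rfl
  let K : Set (WeakBilin B) := D '' {b | 0 ≤ b ∧ b ≤ algebraMap ℝ M C}
  have hKc : Convex ℝ K := by
    rintro _ ⟨b, ⟨hb, hb'⟩, rfl⟩ _ ⟨c, ⟨hc, hc'⟩, rfl⟩ s t hs ht hst
    refine ⟨s • b + t • c, ⟨by positivity, ?_⟩, ?_⟩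
    · calc _ ≤ s • algebraMap ℝ M C + t • algebraMap ℝ M C := by gcongr
        _ = _ := by rw [← add_smul, hst, one_smul]
    · apply LinearMap.ext
      intro a
      change τ (a * (s • b + t • c)) = (s : ℝ) • τ (a * b) + (t : ℝ) • τ (a * c)
      simp only [← Complex.coe_smul, mul_add, mul_smul_comm, τ.map_add, τ.map_smul, smul_eq_mul]
  have hKcl : IsClosed K := by
    rw [isClosed_iff_ultrafilter]
    intro ψ u hu hK
    -- Densities are chosen for every ψ, with the irrelevant value 0 off K, so that the norm bound
    -- required for the ultrafilter limit holds at all indices.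
    have hch : ∀ ψ : WeakBilin B, ∃ b : M, 0 ≤ b ∧ b ≤ algebraMap ℝ M C ∧ (ψ ∈ K → D b = ψ) := by
      intro ψ
      by_cases h : ψ ∈ K
      · obtain ⟨b, hb, rfl⟩ := h
        exact ⟨b, hb.1, hb.2, fun _ => rfl⟩
      · exact ⟨0, le_rfl, hCM, fun h' => (h h').elim⟩
    choose x hx0 hxC hx using hch
    obtain ⟨b, hb⟩ := hτ.exists_limit u x (‖algebraMap ℝ M C‖) fun i =>
      CStarAlgebra.norm_le_norm_of_nonneg_of_le (hx0 i) (hxC i)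
    have hev : ∀ a : M, Tendsto (fun χ : WeakBilin B => B χ a) u (𝓝 (B ψ a)) := fun a =>
      ((WeakBilin.eval_continuous B a).tendsto ψ).mono_left hu
    have key : ∀ a : M, Tendsto (fun χ => τ (a * x χ)) u (𝓝 (B ψ a)) := fun a =>
      (hev a).congr' (by
        filter_upwards [hK] with χ hχ
        rw [← D_apply, hx χ hχ])
    refine ⟨b, ⟨?_, ?_⟩, ?_⟩
    · refine τ.nonneg_of_map_mul_nonneg fun c hc => ?_
      rw [τ.tracial]
      exact ge_of_tendsto' (hb c) fun χ => τ.map_mul_nonneg hc (hx0 χ)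
    · rw [← sub_nonneg]
      refine τ.nonneg_of_map_mul_nonneg fun c hc => ?_
      rw [τ.tracial, mul_sub, τ.map_sub, sub_nonneg]
      refine le_of_tendsto' (hb c) fun χ => ?_
      rw [← sub_nonneg, ← τ.map_sub, ← mul_sub]
      exact τ.map_mul_nonneg hc (sub_nonneg.2 (hxC χ))
    · exact LinearMap.ext fun a => tendsto_nhds_unique (hb a) (key a)
  have hmem : (φ : WeakBilin B) ∈ K := by
    by_contra hn
    -- Separation would put Re φ(a) strictly above the supremum of Re τ(ab) over 0 ≤ b ≤ C,
    -- contradicting φ ≤ Cτ.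
    obtain ⟨f, s, hs, hsφ⟩ := RCLike.geometric_hahn_banach_closed_point (𝕜 := ℂ) hKc hKcl hn
    obtain ⟨a, rfl⟩ := LinearMap.dualEmbedding_surjective B f
    have hs' : ∀ b : M, 0 ≤ b → b ≤ algebraMap ℝ M C → (τ (a * b)).re < s := fun b h1 h2 =>
      hs _ ⟨b, ⟨h1, h2⟩, rfl⟩
    have hsφ' : s < (φ a).re := hsφ
    exact absurd (τ.re_map_le_of_forall_le φ hφ hC0 hC a fun b h1 h2 => (hs' b h1 h2).le) hsφ'.not_ge
  obtain ⟨b, hb, h⟩ := hmem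
  exact ⟨b, hb.1, fun a => (LinearMap.congr_fun h a).symm⟩

end Riesz

section Harnack
variable {A : Type*} [CStarAlgebra A] [PartialOrder A] [StarOrderedRing A]

namespace LOne
variable {τ : FaithfulTrace A}

/-- A Harnack inequality with constant `κ`: `κ (G · x) ≤ G · y` for all non-zero `x, y ≥ 0`, written
without denominators. -/
def HarnackWith (κ : ℝ) (G : LOne τ → LOne τ) : Prop :=
  ∀ x y, IsPos x → IsPos y → IsPos (tr (G x) 1 • G y - (κ * tr (G y) 1) • G x)

lemma IsPos.tr_eq_re {x : LOne τ} (hx : IsPos x) : tr x 1 = ((tr x 1).re : ℂ) :=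
  Complex.eq_re_of_ofReal_le (r := 0) (by simpa using hx.tr_nonneg)

lemma IsPos.re_pos {x : LOne τ} (hx : IsPos x) (h : x ≠ 0) : 0 < (tr x 1).re :=
  (Complex.lt_def.1 (hx.tr_pos h)).1

lemma ne_zero_of_mem_states {x : LOne τ} (hx : x ∈ states τ) : x ≠ 0 := by
  rintro rfl
  have := hx.2
  rw [tr_zero] at this
  exact zero_ne_one this

lemma smul_mem_states {x : LOne τ} (hx : IsPos x) (h : x ≠ 0) : (tr x 1)⁻¹ • x ∈ states τ := by
  refine ⟨hx.smul (by simpa using inv_nonneg.2 hx.tr_nonneg), ?_⟩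
  rw [tr_smul, inv_mul_cancel₀ (hx.tr_pos h).ne']

lemma le_one_of_isPos_sub {x y : LOne τ} (hx : x ∈ states τ) (hy : y ∈ states τ) {l : ℝ}
    (hl : IsPos (x - (l : ℂ) • y)) : l ≤ 1 := by
  have := hl.tr_nonneg
  rw [tr_sub, tr_smul, hx.2, hy.2, mul_one, sub_nonneg] at this
  exact_mod_cast this

lemma mQuantity_bddAbove {x y : LOne τ} (hx : x ∈ states τ) (hy : y ∈ states τ) :
    BddAbove {l : ℝ | IsPos (x - (l : ℂ) • y)} :=
  ⟨1, fun _ hl => le_one_of_isPos_sub hx hy hl⟩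

lemma zero_mem_mQuantity_set {x y : LOne τ} (hx : x ∈ states τ) :
    (0 : ℝ) ∈ {l : ℝ | IsPos (x - (l : ℂ) • y)} := by
  simpa using hx.1

lemma mQuantity_nonneg {x y : LOne τ} (hx : x ∈ states τ) (hy : y ∈ states τ) :
    0 ≤ mQuantity x y :=
  le_csSup (mQuantity_bddAbove hx hy) (zero_mem_mQuantity_set hx)

lemma mQuantity_le_one {x y : LOne τ} (hx : x ∈ states τ) (hy : y ∈ states τ) :
    mQuantity x y ≤ 1 :=
  csSup_le ⟨0, zero_mem_mQuantity_set hx⟩ fun _ hl => le_one_of_isPos_sub hx hy hl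

lemma isPos_sub_of_lt_mQuantity {x y : LOne τ} (hx : x ∈ states τ) (hy : y ∈ states τ) {l : ℝ}
    (hl : l < mQuantity x y) : IsPos (x - (l : ℂ) • y) := by
  obtain ⟨k, hk, hlk⟩ := exists_lt_of_lt_csSup ⟨0, zero_mem_mQuantity_set hx⟩ hl
  have : x - (l : ℂ) • y = (x - (k : ℂ) • y) + ((k - l : ℝ) : ℂ) • y := by
    push_cast; module
  rw [this]
  exact hk.add (hy.1.smul (by exact_mod_cast (sub_pos.2 hlk).le))

lemma hennionDist_nonneg {x y : LOne τ} (hx : x ∈ states τ) (hy : y ∈ states τ) :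
    0 ≤ hennionDist x y := by
  have h1 := mQuantity_nonneg hx hy
  have h2 := mQuantity_nonneg hy hx
  have h3 : mQuantity x y * mQuantity y x ≤ 1 :=
    mul_le_one₀ (mQuantity_le_one hx hy) h2 (mQuantity_le_one hy hx)
  exact div_nonneg (by linarith) (by positivity)

lemma hennionDist_le_one {x y : LOne τ} (hx : x ∈ states τ) (hy : y ∈ states τ) :
    hennionDist x y ≤ 1 := by
  have h1 := mQuantity_nonneg hx hy
  have h2 := mQuantity_nonneg hy hx
  have : 0 ≤ mQuantity x y * mQuantity y x := by positivity
  exact div_le_one_of_le₀ (by linarith) (by positivity)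

lemma projAct_smul {γ : LOne τ → LOne τ} (hl : IsLinearMap ℂ γ) {z : ℂ} (hz : z ≠ 0) (x : LOne τ) : projAct γ (z • x) = projAct γ x := by
  rw [projAct, hl.map_smul, tr_smul, smul_smul, projAct, mul_inv, mul_right_comm,
    inv_mul_cancel₀ hz, one_mul]

section
variable {γ : LOne τ → LOne τ} (hl : IsLinearMap ℂ γ) (hp : PositiveMap γ) (hf : FaithfulMap γ)
include hl hp hf

lemma projAct_mem_states {x : LOne τ} (hx : x ∈ states τ) : projAct γ x ∈ states τ :=
  smul_mem_states (hp x hx.1) fun h => ne_zero_of_mem_states hx (hf x hx.1 h)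

/-- Applying γ to λy ≤ x and normalizing both sides multiplies λ by τ(γ(y))/τ(γ(x)). -/
lemma mQuantity_mul_le {x y : LOne τ} (hx : x ∈ states τ) (hy : y ∈ states τ) :
    mQuantity x y * ((tr (γ y) 1).re / (tr (γ x) 1).re) ≤ mQuantity (projAct γ x) (projAct γ y) := by
  have px := (hp x hx.1).re_pos fun h => ne_zero_of_mem_states hx (hf x hx.1 h)
  have py := (hp y hy.1).re_pos fun h => ne_zero_of_mem_states hy (hf y hy.1 h)
  rw [← le_div_iff₀ (by positivity)]
  refine csSup_le ⟨0, zero_mem_mQuantity_set hx⟩ fun l hm => ?_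
  rw [le_div_iff₀ (by positivity)]
  refine le_csSup (mQuantity_bddAbove (projAct_mem_states hl hp hf hx)
    (projAct_mem_states hl hp hf hy)) ?_
  change IsPos _
  have e : projAct γ x - ((l * ((tr (γ y) 1).re / (tr (γ x) 1).re) : ℝ) : ℂ) • projAct γ y =
      (((tr (γ x) 1).re⁻¹ : ℝ) : ℂ) • γ (x - (l : ℂ) • y) := by
    rw [hl.map_sub, hl.map_smul, projAct, projAct, (hp x hx.1).tr_eq_re, (hp y hy.1).tr_eq_re,
      Complex.ofReal_re, Complex.ofReal_re, smul_sub, smul_smul, smul_smul]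
    congr 2
    · push_cast; rfl
    · have : ((tr (γ y) 1).re : ℂ) ≠ 0 := by exact_mod_cast py.ne'
      push_cast
      field_simp
  rw [e]
  exact (hp _ hm).smul (by exact_mod_cast (inv_pos.2 px).le)

/-- The trace factors for (x, y) and (y, x) cancel in the product of the two m-quantities, and t ↦
(1 - t)/(1 + t) is decreasing. -/
lemma hennionDist_projAct_le {x y : LOne τ} (hx : x ∈ states τ) (hy : y ∈ states τ) :
    hennionDist (projAct γ x) (projAct γ y) ≤ hennionDist x y := by
  have px := (hp x hx.1).re_pos fun h => ne_zero_of_mem_states hx (hf x hx.1 h)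
  have py := (hp y hy.1).re_pos fun h => ne_zero_of_mem_states hy (hf y hy.1 h)
  have h1 := mQuantity_mul_le hl hp hf hx hy
  have h2 := mQuantity_mul_le hl hp hf hy hx
  have n1 := mQuantity_nonneg hx hy
  have n2 := mQuantity_nonneg hy hx
  have h3 := mul_le_mul h1 h2 (by positivity) ((by positivity : (0 : ℝ) ≤ _).trans h1)
  have e : mQuantity x y * ((tr (γ y) 1).re / (tr (γ x) 1).re) *
      (mQuantity y x * ((tr (γ x) 1).re / (tr (γ y) 1).re)) = mQuantity x y * mQuantity y x := by
    field_simp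
  rw [e] at h3
  have h4 : 0 ≤ mQuantity x y * mQuantity y x := by positivity
  rw [hennionDist, hennionDist, div_le_div_iff₀ (by linarith) (by linarith)]
  nlinarith

lemma hennionDist_projAct_le_hennionConst_mul {x y : LOne τ} (hx : x ∈ states τ)
    (hy : y ∈ states τ) (hxy : x ≠ y) :
    0 ≤ hennionConst γ ∧
      hennionDist (projAct γ x) (projAct γ y) ≤ hennionConst γ * hennionDist x y := by
  -- A real supremum dominates its members only if the set is bounded; non-expansiveness gives the
  -- bound 1.
  have hb : BddAbove {r | ∃ x ∈ states τ, ∃ y ∈ states τ, x ≠ y ∧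
      r = hennionDist (projAct γ x) (projAct γ y) / hennionDist x y} := by
    refine ⟨1, ?_⟩
    rintro _ ⟨x, hx, y, hy, -, rfl⟩
    exact div_le_one_of_le₀ (hennionDist_projAct_le hl hp hf hx hy) (hennionDist_nonneg hx hy)
  have h := le_csSup hb ⟨x, hx, y, hy, hxy, rfl⟩
  have h0 := hennionDist_nonneg hx hy
  have h1 := hennionDist_nonneg (projAct_mem_states hl hp hf hx) (projAct_mem_states hl hp hf hy)
  refine ⟨(div_nonneg h1 h0).trans h, ?_⟩
  -- If d(x, y) = 0 the quotient carries no information, and non-expansiveness is used directly.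
  -- Definiteness of d is thus never needed.
  rcases h0.eq_or_lt with h2 | h2
  · rw [← h2, mul_zero, h2]
    exact hennionDist_projAct_le hl hp hf hx hy
  · exact (div_le_iff₀ h2).1 h

end

/-- A strict Hennion contraction satisfies a Harnack inequality. -/
theorem exists_harnackWith_of_mem_SHC {γ : LOne τ → LOne τ} (h : γ ∈ SHC τ) :
    ∃ n : ℕ, HarnackWith (1 / (n + 1 : ℝ)) γ := by
  obtain ⟨hl, hp, hf, hc⟩ := h
  set c := max (hennionConst γ) 0 with hcdef
  have hc1 : c < 1 := max_lt hc one_pos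
  have hc0 : 0 ≤ c := le_max_right _ _
  -- Since c ≤ 1, (1 - c)/2 ≤ (1 - c)/(1 + c). The inequality is strict because only λ below the
  -- supremum m are known to be admissible; reciprocals of integers leave countably many constants
  -- for the measure argument.
  obtain ⟨n, hn⟩ := exists_nat_one_div_lt (show 0 < (1 - c) / 2 by linarith)
  set κ : ℝ := 1 / (n + 1 : ℝ) with hκ
  have hκ0 : 0 ≤ κ := by positivity
  refine ⟨n, ?_⟩
  change HarnackWith κ γ
  have key : ∀ x ∈ states τ, ∀ y ∈ states τ, IsPos (projAct γ y - (κ : ℂ) • projAct γ x) := by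
    intro x hx y hy
    have hx' := projAct_mem_states hl hp hf hx
    have hy' := projAct_mem_states hl hp hf hy
    by_cases hxy : x = y
    · subst hxy
      have : projAct γ x - (κ : ℂ) • projAct γ x = ((1 - κ : ℝ) : ℂ) • projAct γ x := by
        push_cast; module
      rw [this]
      exact hx'.1.smul (by exact_mod_cast (by linarith : (0 : ℝ) ≤ 1 - κ))
    · refine isPos_sub_of_lt_mQuantity hy' hx' (hn.trans_le ?_)
      obtain ⟨h0, h1⟩ := hennionDist_projAct_le_hennionConst_mul hl hp hf hx hy hxy
      have h2 : hennionDist (projAct γ x) (projAct γ y) ≤ c :=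
        (h1.trans (mul_le_of_le_one_right h0 (hennionDist_le_one hx hy))).trans (le_max_left _ _)
      have n1 := mQuantity_nonneg hx' hy'
      have n2 := mQuantity_nonneg hy' hx'
      have n3 := mul_le_of_le_one_left n2 (mQuantity_le_one hx' hy')
      have n4 : 0 ≤ mQuantity (projAct γ x) (projAct γ y) * mQuantity (projAct γ y) (projAct γ x) :=
        mul_nonneg n1 n2
      rw [hennionDist, div_le_iff₀ (by linarith)] at h2
      refine le_trans ?_ n3
      nlinarith
  intro x y hx hy
  by_cases hx0 : x = 0
  · subst hx0
    simpa [hl.map_zero, tr_zero] using IsPos.zero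
  by_cases hy0 : y = 0
  · subst hy0
    simpa [hl.map_zero, tr_zero] using IsPos.zero
  have h1 := key _ (smul_mem_states hx hx0) _ (smul_mem_states hy hy0)
  rw [projAct_smul hl (inv_ne_zero (hx.tr_pos hx0).ne'),
    projAct_smul hl (inv_ne_zero (hy.tr_pos hy0).ne')] at h1
  have tx := (hp x hx).tr_pos fun h => hx0 (hf x hx h)
  have ty := (hp y hy).tr_pos fun h => hy0 (hf y hy h)
  have h2 := h1.smul (mul_nonneg tx.le ty.le)
  convert h2 using 1
  rw [projAct, projAct, smul_sub, smul_smul, smul_smul, smul_smul]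
  congr 2
  · rw [mul_assoc, mul_inv_cancel₀ ty.ne', mul_one]
  · have := tx.ne'
    field_simp

end LOne
end Harnack

/-! ### Convergence along a deterministic contracting sequence. -/

section Deterministic
variable {A : Type*} [CStarAlgebra A] [PartialOrder A] [StarOrderedRing A]

/-- A sequence of positive maps on a tracial C*-algebra, each obtained from the preceding one by
applying a positive map, that contains infinitely many disjoint blocks with a uniform Harnack
inequality. -/
structure IsContracting (τ : FaithfulTrace A) (g : ℕ → A →ₗ[ℂ] A) : Prop where
  map_nonneg : ∀ n a, 0 ≤ a → 0 ≤ g n a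
  isUnit_map_one : ∀ n, IsUnit (g n 1)
  succ_nonneg : ∀ n a, 0 ≤ g n a → 0 ≤ g (n + 1) a
  bound : ∀ n, ∃ K : ℝ, ∀ a, 0 ≤ a → (τ (g n a)).re ≤ K * (τ a).re
  harnack : ∃ κ : ℝ, 0 < κ ∧ κ ≤ 1 ∧ ∀ N, ∃ n, N ≤ n ∧ ∃ n', n ≤ n' ∧ ∀ x y, 0 ≤ g n x → 0 ≤ g n y →
    0 ≤ τ (g n' x) • g n' y - (κ * τ (g n' y)) • g n' x

lemma norm_one_le_one : ‖(1 : A)‖ ≤ 1 := by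
  rcases subsingleton_or_nontrivial A with _ | _
  · simp [Subsingleton.elim (1 : A) 0]
  · exact CStarRing.norm_one.le

/-- Conjugation by e^{-1/2} sends e to 1 and preserves order, so the conjugated b lies between α1
and β1, as does z1. Comparing both with α1 costs the factor 2. -/
lemma norm_conj_invSqrt_sub_le {e b : A} (he : 0 ≤ e) (hu : IsUnit e) {α β : ℝ}
    (h1 : (α : ℂ) • e ≤ b) (h2 : b ≤ (β : ℂ) • e) {z : ℝ} (hz1 : α ≤ z) (hz2 : z ≤ β) :
    ‖e ^ (-(1 / 2) : ℝ) * b * e ^ (-(1 / 2) : ℝ) - (z : ℂ) • (1 : A)‖ ≤ 2 * (β - α) := by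
  set s := e ^ (-(1 / 2) : ℝ) with hs
  have hse : s * e * s = 1 := CFC.conjugate_rpow_neg_one_half e (hu.isStrictlyPositive he)
  have hss : star s = s := (CFC.rpow_nonneg (a := e)).isSelfAdjoint.star_eq
  have h3 := star_left_conjugate_le_conjugate h1 s
  have h4 := star_left_conjugate_le_conjugate h2 s
  rw [hss, mul_smul_comm, smul_mul_assoc, hse] at h3 h4
  have h5 : 0 ≤ s * b * s - (α : ℂ) • (1 : A) := sub_nonneg.2 h3
  have h6 : ‖s * b * s - (α : ℂ) • (1 : A)‖ ≤ β - α := by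
    have : s * b * s - (α : ℂ) • (1 : A) ≤ ((β - α : ℝ) : ℂ) • (1 : A) := by
      push_cast
      rw [sub_smul]
      exact sub_le_sub_right h4 _
    refine (CStarAlgebra.norm_le_norm_of_nonneg_of_le h5 this).trans ?_
    rw [norm_smul, Complex.norm_real, Real.norm_of_nonneg (by linarith)]
    exact mul_le_of_le_one_right (by linarith) norm_one_le_one
  have h7 : ‖((z - α : ℝ) : ℂ) • (1 : A)‖ ≤ β - α := by
    rw [norm_smul, Complex.norm_real, Real.norm_of_nonneg (by linarith)]
    exact (mul_le_of_le_one_right (by linarith) norm_one_le_one).trans (by linarith)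
  have h8 : s * b * s - (z : ℂ) • (1 : A) =
      (s * b * s - (α : ℂ) • (1 : A)) - ((z - α : ℝ) : ℂ) • (1 : A) := by
    push_cast; module
  rw [h8]
  exact (norm_sub_le _ _).trans (by linarith)

namespace IsContracting
variable {τ : FaithfulTrace A} {g : ℕ → A →ₗ[ℂ] A} (hg : IsContracting τ g)

lemma _root_.EQP.FaithfulTrace.re_pos_of_isUnit (τ : FaithfulTrace A) {e : A} (he : 0 ≤ e)
    (hu : IsUnit e) : 0 < (τ e).re := by
  refine lt_of_le_of_ne (Complex.le_def.1 (τ.map_nonneg he)).1 fun h => ?_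
  have h0 : e = 0 := τ.faithful he (by rw [← τ.ofReal_re he, ← h]; simp)
  have : Nontrivial A := ⟨1, 0, fun h1 => by
    have := τ.map_one
    rw [h1, τ.map_zero] at this
    exact zero_ne_one this⟩
  exact not_isUnit_zero (h0 ▸ hu)

include hg

lemma nonneg_of_le {n n' : ℕ} (h : n ≤ n') {a : A} (ha : 0 ≤ g n a) : 0 ≤ g n' a := by
  induction n', h using Nat.le_induction with
  | base => exact ha
  | succ k _ ih => exact hg.succ_nonneg k a ih

lemma re_pos (n : ℕ) : 0 < (τ (g n 1)).re :=
  τ.re_pos_of_isUnit (hg.map_nonneg n 1 zero_le_one) (hg.isUnit_map_one n)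

lemma ofReal_re_one (n : ℕ) : ((τ (g n 1)).re : ℂ) = τ (g n 1) :=
  τ.ofReal_re (hg.map_nonneg n 1 zero_le_one)

/-- Starting from ±‖a‖, every Harnack block multiplies the width of the bracket by 1 - κ. The
elements a - α1 and β1 - a need not be positive, only their images are; hence the Harnack hypothesis
is phrased through g n x ≥ 0. -/
lemma exists_squeeze {a : A} (ha : IsSelfAdjoint a) {δ : ℝ} (hδ : 0 < δ) :
    ∃ (N : ℕ) (α β : ℝ), β - α < δ ∧ ∀ n, N ≤ n →
      0 ≤ g n (a - (α : ℂ) • 1) ∧ 0 ≤ g n ((β : ℂ) • 1 - a) := by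
  obtain ⟨κ, hκ, hκ1, hH⟩ := hg.harnack
  have key : ∀ j : ℕ, ∃ (N : ℕ) (α β : ℝ), β - α = (1 - κ) ^ j * (2 * ‖a‖) ∧
      0 ≤ g N (a - (α : ℂ) • 1) ∧ 0 ≤ g N ((β : ℂ) • 1 - a) := by
    intro j
    induction j with
    | zero =>
      refine ⟨0, -‖a‖, ‖a‖, by ring, hg.map_nonneg _ _ ?_, hg.map_nonneg _ _ ?_⟩
      · rw [Complex.ofReal_neg, neg_smul, sub_neg_eq_add, Complex.coe_smul,
          ← Algebra.algebraMap_eq_smul_one]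
        have := ha.neg_algebraMap_norm_le_self
        rwa [neg_le_iff_add_nonneg] at this
      · rw [Complex.coe_smul, ← Algebra.algebraMap_eq_smul_one]
        exact sub_nonneg.2 ha.le_algebraMap_norm_self
    | succ j ih =>
      obtain ⟨N, α, β, hαβ, hu, hv⟩ := ih
      obtain ⟨n, hNn, n', hnn', h⟩ := hH N
      set u := a - (α : ℂ) • (1 : A) with hudef
      set v := (β : ℂ) • (1 : A) - a with hvdef
      have h1 := hg.nonneg_of_le (Nat.zero_le n) (hg.map_nonneg 0 1 zero_le_one)
      have hu1 := h 1 u h1 (hg.nonneg_of_le hNn hu)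
      have hv1 := h 1 v h1 (hg.nonneg_of_le hNn hv)
      rw [← hg.ofReal_re_one, ← τ.ofReal_re (hg.nonneg_of_le (hNn.trans hnn') hu)] at hu1
      rw [← hg.ofReal_re_one, ← τ.ofReal_re (hg.nonneg_of_le (hNn.trans hnn') hv)] at hv1
      have ht := hg.re_pos n'
      have hsum : (τ (g n' u)).re + (τ (g n' v)).re = (β - α) * (τ (g n' 1)).re := by
        have : u + v = ((β - α : ℝ) : ℂ) • (1 : A) := by
          rw [hudef, hvdef]; push_cast; module
        rw [← Complex.add_re, ← τ.map_add, ← map_add, this, map_smul, τ.map_smul,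
          Complex.re_ofReal_mul]
      have hsm : ∀ (w : A) (p : ℝ), 0 ≤ ((τ (g n' 1)).re : ℂ) • g n' w - ((κ : ℂ) * p) • g n' 1 →
          0 ≤ g n' (w - ((κ * p / (τ (g n' 1)).re : ℝ) : ℂ) • 1) := by
        intro w p hp
        have e : g n' (w - ((κ * p / (τ (g n' 1)).re : ℝ) : ℂ) • 1) = (((τ (g n' 1)).re⁻¹ : ℝ) : ℂ) •
            (((τ (g n' 1)).re : ℂ) • g n' w - ((κ : ℂ) * p) • g n' 1) := by
          have : ((τ (g n' 1)).re : ℂ) ≠ 0 := by exact_mod_cast ht.ne'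
          rw [map_sub, map_smul, smul_sub, smul_smul, smul_smul]
          push_cast
          rw [inv_mul_cancel₀ this, one_smul, div_eq_inv_mul]
        rw [e]
        exact smul_nonneg (by exact_mod_cast (inv_pos.2 ht).le) hp
      -- Comparing u and v with 1 raises the lower end and lowers the upper one. Because u + v = (β
      -- - α)1, the two gains add up to exactly κ(β - α).
      refine ⟨n', α + κ * (τ (g n' u)).re / (τ (g n' 1)).re,
        β - κ * (τ (g n' v)).re / (τ (g n' 1)).re, ?_, ?_, ?_⟩
      · have : κ * (τ (g n' u)).re / (τ (g n' 1)).re + κ * (τ (g n' v)).re / (τ (g n' 1)).re =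
            κ * (β - α) := by
          rw [← add_div, ← mul_add, hsum]; field_simp
        rw [pow_succ]
        linear_combination (1 - κ) * hαβ - this
      · convert hsm u _ hu1 using 2
        rw [hudef]; push_cast; module
      · convert hsm v _ hv1 using 2
        rw [hvdef]; push_cast; module
  have hlim : Tendsto (fun j : ℕ => (1 - κ) ^ j * (2 * ‖a‖)) atTop (𝓝 0) := by
    simpa using (tendsto_pow_atTop_nhds_zero_of_lt_one (by linarith) (by linarith)).mul_const
      (2 * ‖a‖)
  obtain ⟨j, hj⟩ := (hlim.eventually_lt_const hδ).exists
  obtain ⟨N, α, β, h, hu, hv⟩ := key j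
  exact ⟨N, α, β, h ▸ hj, fun n hn => ⟨hg.nonneg_of_le hn hu, hg.nonneg_of_le hn hv⟩⟩

omit hg in
/-- The normalized functional `a ↦ τ(g_n(a)) / τ(g_n(1))`. -/
noncomputable def _root_.EQP.ratio (τ : FaithfulTrace A) (g : ℕ → A →ₗ[ℂ] A) (n : ℕ) : A →ₗ[ℂ] ℂ :=
  (τ (g n 1))⁻¹ • (τ.toPositiveLinearMap.toLinearMap ∘ₗ g n)

omit hg in
lemma ratio_apply (n : ℕ) (a : A) : ratio τ g n a = τ (g n a) / τ (g n 1) :=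
  (div_eq_inv_mul _ _).symm

lemma ratio_one (n : ℕ) : ratio τ g n 1 = 1 := by
  rw [ratio_apply, div_self]
  rw [← hg.ofReal_re_one]
  exact_mod_cast (hg.re_pos n).ne'

lemma ratio_nonneg {n : ℕ} {a : A} (ha : 0 ≤ g n a) : 0 ≤ ratio τ g n a := by
  rw [ratio_apply, ← hg.ofReal_re_one, ← τ.ofReal_re ha]
  exact_mod_cast div_nonneg (Complex.le_def.1 (τ.map_nonneg ha)).1 (hg.re_pos n).le

lemma ratio_eq_re {a : A} (ha : IsSelfAdjoint a) (n : ℕ) :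
    ratio τ g n a = ((ratio τ g n a).re : ℂ) :=
  Complex.ext rfl (im_eq_zero_of_nonneg (ratio τ g n)
    (fun _ hc => hg.ratio_nonneg (hg.map_nonneg n _ hc)) a ha)

lemma ratio_mem {n : ℕ} {a : A} {α β : ℝ} (h1 : 0 ≤ g n (a - (α : ℂ) • 1))
    (h2 : 0 ≤ g n ((β : ℂ) • 1 - a)) : α ≤ (ratio τ g n a).re ∧ (ratio τ g n a).re ≤ β := by
  have h3 := (Complex.le_def.1 (hg.ratio_nonneg h1)).1
  have h4 := (Complex.le_def.1 (hg.ratio_nonneg h2)).1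
  rw [map_sub, map_smul, hg.ratio_one] at h3 h4
  simp at h3 h4
  exact ⟨h3, h4⟩

lemma exists_tendsto_ratio (a : A) : ∃ l, Tendsto (fun n => ratio τ g n a) atTop (𝓝 l) := by
  have hsa : ∀ a, IsSelfAdjoint a → ∃ l, Tendsto (fun n => ratio τ g n a) atTop (𝓝 l) := by
    intro a ha
    refine cauchySeq_tendsto_of_complete (Metric.cauchySeq_iff'.2 fun ε hε => ?_)
    obtain ⟨N, α, β, hδ, h⟩ := hg.exists_squeeze ha hε
    refine ⟨N, fun n hn => ?_⟩
    have h1 := hg.ratio_mem (h n hn).1 (h n hn).2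
    have h2 := hg.ratio_mem (h N le_rfl).1 (h N le_rfl).2
    rw [hg.ratio_eq_re ha n, hg.ratio_eq_re ha N, dist_eq_norm, ← Complex.ofReal_sub,
      Complex.norm_real, Real.norm_eq_abs, abs_lt]
    constructor <;> linarith
  obtain ⟨l1, h1⟩ := hsa _ (realPart a).2
  obtain ⟨l2, h2⟩ := hsa _ (imaginaryPart a).2
  refine ⟨l1 + Complex.I • l2, (h1.add (h2.const_smul Complex.I)).congr fun n => ?_⟩
  conv_rhs => rw [← realPart_add_I_smul_imaginaryPart a]
  rw [map_add, map_smul]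

/-- One Harnack block, comparing a with 1, bounds g(a) by a multiple τ(g(a))/(κ τ(g(1))) of g(1).
Later maps preserve this, and τ(g(a)) ≤ Kτ(a) at that one fixed time. -/
lemma exists_ratio_bound : ∃ C : ℝ, ∀ a, 0 ≤ a → ∀ᶠ n in atTop,
    (ratio τ g n a).re ≤ C * (τ a).re := by
  obtain ⟨κ, hκ, hκ1, hH⟩ := hg.harnack
  obtain ⟨n, -, n', hn, h⟩ := hH 0
  obtain ⟨K, hK⟩ := hg.bound n'
  have ht := hg.re_pos n'
  refine ⟨K / (κ * (τ (g n' 1)).re), fun a ha => ?_⟩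
  filter_upwards [eventually_ge_atTop n'] with m hm
  have h1 := h a 1 (hg.map_nonneg _ _ ha) (hg.map_nonneg _ _ zero_le_one)
  rw [← map_smul, ← map_smul, ← map_sub] at h1
  have h2 := (Complex.le_def.1 (hg.ratio_nonneg (hg.nonneg_of_le hm h1))).1
  rw [map_sub, map_smul, map_smul, hg.ratio_one, ← τ.ofReal_re (hg.map_nonneg _ _ ha),
    ← hg.ofReal_re_one, ← Complex.ofReal_mul, smul_eq_mul, smul_eq_mul, Complex.sub_re,
    Complex.re_ofReal_mul, Complex.re_ofReal_mul, Complex.one_re, Complex.zero_re, mul_one] at h2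
  rw [div_mul_eq_mul_div, le_div_iff₀ (by positivity), mul_comm]
  linarith [hK a ha]

/-- For self-adjoint a, a short bracket confines both the conjugated element and the scalar ratio,
so their difference vanishes in operator norm; general a splits into real and imaginary parts. -/
lemma tendsto_conj_of_tendsto_ratio {φ : A →ₗ[ℂ] ℂ}
    (hφ : ∀ a, Tendsto (fun n => ratio τ g n a) atTop (𝓝 (φ a))) (a : A) :
    Tendsto (fun n => (g n 1) ^ (-(1 / 2) : ℝ) * g n a * (g n 1) ^ (-(1 / 2) : ℝ)) atTop
      (𝓝 (φ a • (1 : A))) := by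
  have hsa : ∀ a, IsSelfAdjoint a →
      Tendsto (fun n => (g n 1) ^ (-(1 / 2) : ℝ) * g n a * (g n 1) ^ (-(1 / 2) : ℝ)) atTop
        (𝓝 (φ a • (1 : A))) := by
    intro a ha
    have h0 : Tendsto (fun n => (g n 1) ^ (-(1 / 2) : ℝ) * g n a * (g n 1) ^ (-(1 / 2) : ℝ) -
        ratio τ g n a • (1 : A)) atTop (𝓝 0) := by
      rw [Metric.tendsto_atTop]
      intro ε hε
      obtain ⟨N, α, β, hδ, h⟩ := hg.exists_squeeze ha (half_pos hε)
      refine ⟨N, fun n hn => ?_⟩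
      obtain ⟨h1, h2⟩ := h n hn
      obtain ⟨h3, h4⟩ := hg.ratio_mem h1 h2
      rw [map_sub, map_smul, sub_nonneg] at h1 h2
      rw [dist_zero_right, hg.ratio_eq_re ha n]
      have := norm_conj_invSqrt_sub_le (hg.map_nonneg n 1 zero_le_one) (hg.isUnit_map_one n) h1 h2 h3 h4
      linarith
    simpa using h0.add ((hφ a).smul_const (1 : A))
  have h1 := hsa _ (realPart a).2
  have h2 := hsa _ (imaginaryPart a).2
  have h3 := h1.add (h2.const_smul Complex.I)
  have e : φ a • (1 : A) = φ (realPart a : A) • (1 : A) +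
      Complex.I • φ (imaginaryPart a : A) • (1 : A) := by
    conv_lhs => rw [← realPart_add_I_smul_imaginaryPart a]
    rw [map_add, map_smul, add_smul, smul_assoc]
  rw [e]
  refine h3.congr fun n => ?_
  conv_rhs => rw [← realPart_add_I_smul_imaginaryPart a]
  rw [map_add, map_smul, mul_add, add_mul, mul_smul_comm, smul_mul_assoc]

/-- The normalized functionals converge to a state that is dominated by a multiple of `τ`. -/
theorem exists_limit : ∃ φ : A →ₗ[ℂ] ℂ, (∀ a, Tendsto (fun n => ratio τ g n a) atTop (𝓝 (φ a))) ∧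
    (∀ a, 0 ≤ a → 0 ≤ φ a) ∧ φ 1 = 1 ∧ ∃ C : ℝ, ∀ a, 0 ≤ a → (φ a).re ≤ C * (τ a).re := by
  choose l hl using hg.exists_tendsto_ratio
  refine ⟨linearMapOfTendsto l (ratio τ g) (tendsto_pi_nhds.2 hl), hl, fun a ha => ?_, ?_, ?_⟩
  · exact ge_of_tendsto' (hl a) fun n => hg.ratio_nonneg (hg.map_nonneg n a ha)
  · exact tendsto_nhds_unique (hl 1) (by simp [hg.ratio_one])
  · obtain ⟨C, hC⟩ := hg.exists_ratio_bound
    exact ⟨C, fun a ha => le_of_tendsto ((Complex.continuous_re.tendsto _).comp (hl a)) (hC a ha)⟩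

end IsContracting
end Deterministic

/-! ### Orbits, recurrence and measurability. -/

section Measurability
variable {Ω : Type*} [MeasurableSpace Ω]


lemma iter_one (T : Ω ≃ᵐ Ω) (ω : Ω) : iter T 1 ω = T ω := by
  rw [iter, zpow_one]; rfl

lemma iter_neg_one (T : Ω ≃ᵐ Ω) (ω : Ω) : iter T (-1) ω = T.symm ω := by
  rw [iter, zpow_neg_one]; rfl

lemma iter_add (T : Ω ≃ᵐ Ω) (j k : ℤ) (ω : Ω) : iter T (j + k) ω = iter T j (iter T k ω) := by
  rw [iter, zpow_add]; rfl

lemma iter_natCast (T : Ω ≃ᵐ Ω) (n : ℕ) (ω : Ω) : iter T n ω = T^[n] ω := by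
  induction n with
  | zero => rfl
  | succ n ih =>
    rw [Nat.cast_succ, add_comm, iter_add, ih, iter_one, Function.iterate_succ_apply']

lemma measurePreserving_iter {P : Measure Ω} {T : Ω ≃ᵐ Ω} (hT : MeasurePreserving T P P) (k : ℤ) :
    MeasurePreserving (iter T k) P P := by
  have hs : MeasurePreserving T.symm P P := hT.symm T
  induction k using Int.induction_on with
  | zero => exact MeasurePreserving.id P
  | succ k ih =>
    have : iter T (k + 1) = T ∘ iter T k := by
      ext ω; rw [add_comm, iter_add, iter_one]; rfl
    rw [this]; exact hT.comp ih
  | pred k ih =>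
    have : iter T (-k - 1) = T.symm ∘ iter T (-k) := by
      ext ω; rw [sub_eq_add_neg, add_comm, iter_add, iter_neg_one]; rfl
    rw [this]; exact hs.comp ih

/-- Infinitely many visits to a set of positive measure, for an ergodic map. -/
lemma ae_frequently_mem_of_ergodic {P : Measure Ω} [IsFiniteMeasure P] {f : Ω → Ω}
    (hf : Ergodic f P) {E : Set Ω} (hE : NullMeasurableSet E P) (h0 : P E ≠ 0) :
    ∀ᵐ ω ∂P, ∃ᶠ n in atTop, f^[n] ω ∈ E := by
  set S : Set Ω := {ω | ∃ᶠ n in atTop, f^[n] ω ∈ E} with hS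
  have hSm : NullMeasurableSet S P := by
    have : S = ⋂ N : ℕ, ⋃ n : ℕ, ⋃ _ : N ≤ n, f^[n] ⁻¹' E := by
      ext ω
      simp [hS, frequently_atTop]
    rw [this]
    exact .iInter fun N => .iUnion fun n => .iUnion fun _ =>
      hE.preimage (hf.toMeasurePreserving.quasiMeasurePreserving.iterate n)
  have hinv : f ⁻¹' S = S := by
    ext ω
    simp only [hS, Set.mem_preimage, Set.mem_ofPred_eq, ← Function.iterate_succ_apply]
    conv_rhs => rw [← map_add_atTop_eq_nat 1, frequently_map]
  rcases hf.quasiErgodic.ae_mem_or_ae_notMem₀ hSm (by rw [hinv]; exact ae_eq_refl _) with h | h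
  · exact h
  · refine (h0 ?_).elim
    -- By Poincaré recurrence almost every point of E returns to E infinitely often, so the other
    -- alternative of ergodicity would make E null.
    have := hf.toMeasurePreserving.conservative.ae_mem_imp_frequently_image_mem hE
    rw [measure_eq_zero_iff_ae_notMem]
    filter_upwards [this, h] with ω h1 h2 h3
    exact h2 (h1 h3)

section Operators
variable {X : Type*} [NormedAddCommGroup X] [NormedSpace ℂ X] {P : Measure Ω}

lemma IsBoundedRandomLinearOperator.comp_measurePreserving {γ : Ω → X → X}
    (hγ : IsBoundedRandomLinearOperator P γ) {f : Ω → Ω} (hf : MeasurePreserving f P P) :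
    IsBoundedRandomLinearOperator P fun ω => γ (f ω) where
  aestronglyMeasurable x := (hγ.aestronglyMeasurable x).comp_measurePreserving hf
  isBoundedLinearMap := hf.quasiMeasurePreserving.ae hγ.isBoundedLinearMap

/-- Applying a bounded random linear operator to a random vector gives a random vector. -/
lemma IsBoundedRandomLinearOperator.aestronglyMeasurable_apply {γ : Ω → X → X}
    (hγ : IsBoundedRandomLinearOperator P γ) {f : Ω → X} (hf : AEStronglyMeasurable f P) :
    AEStronglyMeasurable (fun ω => γ ω (f ω)) P := by
  obtain ⟨f', hf', hff'⟩ := hf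
  have hs : ∀ s : SimpleFunc Ω X, AEStronglyMeasurable (fun ω => γ ω (s ω)) P := by
    intro s
    have e : (fun ω => γ ω (s ω)) =
        fun ω => ∑ y ∈ s.range, (s ⁻¹' {y}).indicator (fun ω => γ ω y) ω := by
      ext ω
      rw [Finset.sum_eq_single (s ω)]
      · rw [Set.indicator_of_mem]; rfl
      · intro y _ hy
        exact Set.indicator_of_notMem (fun h => hy h.symm) _
      · exact fun h => (h (s.mem_range_self ω)).elim
    rw [e]
    exact Finset.aestronglyMeasurable_fun_sum _ fun y _ =>
      (hγ.aestronglyMeasurable y).indicator (s.measurableSet_preimage {y})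
  refine (aestronglyMeasurable_of_tendsto_ae atTop (fun n => hs (hf'.approx n))
    (g := fun ω => γ ω (f' ω)) ?_).congr (hff'.mono fun ω h => by simp only [h])
  filter_upwards [hγ.isBoundedLinearMap] with ω hω
  exact (hω.continuous.tendsto _).comp (hf'.tendsto_approx ω)

lemma aestronglyMeasurable_processAux {T : Ω ≃ᵐ Ω} (hT : MeasurePreserving T P P) {γ : Ω → X → X}
    (hγ : IsBoundedRandomLinearOperator P γ) (m : ℤ) (k : ℕ) (x : X) :
    AEStronglyMeasurable (fun ω => processAux T γ m k ω x) P := by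
  induction k with
  | zero => exact (hγ.comp_measurePreserving (measurePreserving_iter hT m)).aestronglyMeasurable x
  | succ k ih =>
    exact (hγ.comp_measurePreserving (measurePreserving_iter hT _)).aestronglyMeasurable_apply ih

end Operators

section Iterates
variable {X : Type*} {T : Ω ≃ᵐ Ω} {γ : Ω → X → X}

lemma processAux_iter (m j : ℤ) (k : ℕ) (ω : Ω) :
    processAux T γ m k (iter T j ω) = processAux T γ (m + j) k ω := by
  induction k with
  | zero => rw [processAux, processAux, iter_add]
  | succ k ih =>
    rw [processAux, processAux, ih, ← iter_add]
    congr 3; ring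

lemma processAux_add (m : ℤ) (j k : ℕ) (ω : Ω) :
    processAux T γ m (j + 1 + k) ω =
      processAux T γ (m + (j + 1 : ℕ)) k ω ∘ processAux T γ m j ω := by
  induction k with
  | zero => rfl
  | succ k ih =>
    rw [← add_assoc, processAux, ih, processAux, Function.comp_assoc]
    congr 3; push_cast; ring

lemma processAux_pred (m : ℤ) (k : ℕ) (ω : Ω) :
    processAux T γ (m - 1) (k + 1) ω = processAux T γ m k ω ∘ γ (iter T (m - 1) ω) := by
  have := processAux_add (T := T) (γ := γ) (m - 1) 0 k ω
  rw [show 0 + 1 + k = k + 1 by ring] at this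
  rw [this]
  congr 2
  push_cast; ring

end Iterates

section LOne
variable {A : Type*} [CStarAlgebra A] [PartialOrder A] [StarOrderedRing A] {τ : FaithfulTrace A}

/-- In a separable `L¹(M, τ)`, countably many contractions of `M` are norming. -/
lemma LOne.exists_norming [TopologicalSpace.SeparableSpace (LOne τ)] :
    ∃ b : ℕ × ℕ → A, (∀ i, ‖b i‖ ≤ 1) ∧
      ∀ (x : LOne τ) (r : ℝ), (∀ i, ‖LOne.tr x (b i)‖ ≤ r) → ‖x‖ ≤ r := by
  have h := fun i : ℕ × ℕ => LOne.exists_norm_le (TopologicalSpace.denseSeq (LOne τ) i.1)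
    (show (0 : ℝ) < 1 / (i.2 + 1) by positivity)
  choose b hb h using h
  refine ⟨b, hb, fun x r hr => le_of_forall_pos_le_add fun ε hε => ?_⟩
  obtain ⟨n, hn⟩ := exists_nat_one_div_lt (show 0 < ε / 3 by linarith)
  obtain ⟨k, hk⟩ := (TopologicalSpace.denseRange_denseSeq (LOne τ)).exists_dist_lt x
    (show 0 < ε / 3 by linarith)
  set y := TopologicalSpace.denseSeq (LOne τ) k
  rw [dist_eq_norm] at hk
  have h1 := h (k, n)
  have h2 := hr (k, n)
  have h3 : ‖LOne.tr (y - x) (b (k, n))‖ ≤ ‖x - y‖ := by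
    rw [← norm_neg (x - y), neg_sub]
    exact (LOne.norm_tr_le _ _).trans (mul_le_of_le_one_left (norm_nonneg _) (hb _))
  rw [LOne.tr_sub] at h3
  have h4 := norm_sub_norm_le (LOne.tr y (b (k, n))) (LOne.tr x (b (k, n)))
  have h5 : ‖x‖ ≤ ‖x - y‖ + ‖y‖ := by simpa using norm_add_le (x - y) y
  simp only at h1 hn
  linarith

/-- A form of Pettis' theorem: a weakly measurable map into a separable `L¹(M, τ)` is strongly
measurable. -/
lemma LOne.aestronglyMeasurable_of_tr [TopologicalSpace.SeparableSpace (LOne τ)] {P : Measure Ω}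
    {f : Ω → LOne τ} (hf : ∀ b, AEMeasurable (fun ω => LOne.tr (f ω) b) P) :
    AEStronglyMeasurable f P := by
  borelize (LOne τ)
  obtain ⟨b, hb, hn⟩ := LOne.exists_norming (τ := τ)
  have hball : ∀ (x : LOne τ) (r : ℝ), NullMeasurableSet (f ⁻¹' Metric.closedBall x r) P := by
    intro x r
    -- Countably many norming contractions turn membership in a ball into countably many scalar
    -- conditions.
    have : f ⁻¹' Metric.closedBall x r = ⋂ i, {ω | ‖LOne.tr (f ω) (b i) - LOne.tr x (b i)‖ ≤ r} := by
      ext ω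
      simp only [Set.mem_preimage, mem_closedBall_iff_norm, Set.mem_iInter, Set.mem_ofPred_eq,
        ← LOne.tr_sub]
      exact ⟨fun h i => (LOne.norm_tr_le _ _).trans
        ((mul_le_of_le_one_left (norm_nonneg _) (hb i)).trans h), hn _ _⟩
    rw [this]
    exact .iInter fun i => nullMeasurableSet_le ((hf (b i)).sub_const _).norm aemeasurable_const
  have : SecondCountableTopology (LOne τ) := UniformSpace.secondCountable_of_separable _
  have hnm : NullMeasurable f P := by
    have : Measurable[_, borel (LOne τ)] (fun ω : NullMeasurableSpace Ω P => f ω) := by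
      refine measurable_of_isOpen fun U hU => ?_
      obtain ⟨D, hDc, hDd⟩ := TopologicalSpace.exists_countable_dense (LOne τ)
      -- By separability, an open set is a countable union of closed balls.
      have e : f ⁻¹' U = ⋃ x ∈ D, ⋃ n : ℕ, ⋃ _ : Metric.closedBall x (1 / (n + 1 : ℝ)) ⊆ U,
          f ⁻¹' Metric.closedBall x (1 / (n + 1 : ℝ)) := by
        ext ω
        simp only [Set.mem_preimage, Set.mem_iUnion, exists_prop]
        refine ⟨fun h => ?_, fun ⟨x, _, n, hs, h⟩ => hs h⟩
        obtain ⟨ε, hε, hεU⟩ := Metric.isOpen_iff.1 hU _ h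
        obtain ⟨n, hn⟩ := exists_nat_one_div_lt (half_pos hε)
        obtain ⟨x, hxD, hx⟩ := hDd.exists_dist_lt (f ω) (show (0 : ℝ) < 1 / (n + 1) by positivity)
        refine ⟨x, hxD, n, fun y hy => hεU ?_, hx.le⟩
        rw [Metric.mem_closedBall] at hy
        rw [Metric.mem_ball]
        have := dist_triangle y x (f ω)
        rw [dist_comm x] at this
        linarith
      change NullMeasurableSet (f ⁻¹' U) P
      rw [e]
      exact .biUnion hDc fun x _ => .iUnion fun n => .iUnion fun _ => hball _ _
    exact fun s hs => this hs
  exact hnm.aemeasurable.aestronglyMeasurable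

/-- The positive cone is closed, hence the zero set of a continuous distance function. -/
lemma LOne.nullMeasurableSet_isPos {P : Measure Ω} {f : Ω → LOne τ}
    (hf : AEStronglyMeasurable f P) : NullMeasurableSet {ω | LOne.IsPos (f ω)} P := by
  have : {ω | LOne.IsPos (f ω)} = {ω | Metric.infDist (f ω) {x | LOne.IsPos x} = 0} := by
    ext ω
    exact LOne.isClosed_isPos.mem_iff_infDist_zero ⟨0, LOne.IsPos.zero⟩
  rw [this]
  exact nullMeasurableSet_eq_fun
    ((Metric.continuous_infDist_pt _).comp_aestronglyMeasurable hf).aemeasurable aemeasurable_const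

/-- For continuous G the inequality is a closed condition in each of x and y, so testing on a
countable dense subset of the cone is enough. -/
lemma LOne.nullMeasurableSet_harnackWith [TopologicalSpace.SeparableSpace (LOne τ)] {P : Measure Ω}
    {G : Ω → LOne τ → LOne τ} (hG : ∀ x, AEStronglyMeasurable (fun ω => G ω x) P)
    (hc : ∀ᵐ ω ∂P, Continuous (G ω)) (κ : ℝ) :
    NullMeasurableSet {ω | LOne.HarnackWith κ (G ω)} P := by
  have : SecondCountableTopology (LOne τ) := UniformSpace.secondCountable_of_separable _
  obtain ⟨D, hDs, hDc, hDd⟩ := TopologicalSpace.IsSeparable.exists_countable_dense_subset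
    (TopologicalSpace.IsSeparable.of_separableSpace {x : LOne τ | LOne.IsPos x})
  have h1 : NullMeasurableSet (⋂ x ∈ D, ⋂ y ∈ D, {ω | LOne.IsPos
      (LOne.tr (G ω x) 1 • G ω y - (κ * LOne.tr (G ω y) 1) • G ω x)}) P := by
    refine .biInter hDc fun x _ => .biInter hDc fun y _ => LOne.nullMeasurableSet_isPos ?_
    have ht : ∀ x, AEStronglyMeasurable (fun ω => LOne.tr (G ω x) 1) P := fun x =>
      (LOne.continuous_tr 1).comp_aestronglyMeasurable (hG x)
    exact ((ht x).smul (hG y)).sub (((ht y).const_mul _).smul (hG x))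
  refine h1.congr ?_
  filter_upwards [hc] with ω hω
  refine propext ?_
  change ω ∈ (⋂ x ∈ D, ⋂ y ∈ D, _) ↔ LOne.HarnackWith κ (G ω)
  simp only [Set.mem_iInter]
  refine ⟨fun h x y hx hy => ?_, fun h x hx y hy => h x y (hDs hx) (hDs hy)⟩
  have ct : Continuous fun x => LOne.tr (G ω x) 1 := (LOne.continuous_tr (τ := τ) 1).comp hω
  have cs : ∀ c : ℂ, Continuous fun x => c • G ω x := fun c => (continuous_const_smul c).comp hω
  have hcl1 : ∀ y, IsClosed {x | LOne.IsPos
      (LOne.tr (G ω x) 1 • G ω y - (κ * LOne.tr (G ω y) 1) • G ω x)} := fun y =>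
    have c : Continuous fun x =>
        LOne.tr (G ω x) 1 • G ω y - (κ * LOne.tr (G ω y) 1) • G ω x :=
      (ct.smul continuous_const).sub (cs _)
    LOne.isClosed_isPos.preimage c
  have hcl2 : ∀ x, IsClosed {y | LOne.IsPos
      (LOne.tr (G ω x) 1 • G ω y - (κ * LOne.tr (G ω y) 1) • G ω x)} := fun x =>
    have c : Continuous fun y =>
        LOne.tr (G ω x) 1 • G ω y - (κ * LOne.tr (G ω y) 1) • G ω x :=
      (cs _).sub ((continuous_const.mul ct).smul continuous_const)
    LOne.isClosed_isPos.preimage c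
  have h2 : ∀ y ∈ D, ∀ x ∈ closure D, LOne.IsPos
      (LOne.tr (G ω x) 1 • G ω y - (κ * LOne.tr (G ω y) 1) • G ω x) := fun y hy x hx =>
    closure_minimal (fun x hx => h x hx y hy) (hcl1 y) hx
  exact closure_minimal (fun y hy' => h2 y hy' x (hDd hx)) (hcl2 x) (hDd hy)

end LOne
end Measurability

/-! ### Restriction to M, limit states and ‖·‖₁ bounds. -/

section Regular
variable {A : Type*} [CStarAlgebra A] [PartialOrder A] [StarOrderedRing A] {τ : FaithfulTrace A}

lemma exists_pos_smul_one_le {e : A} (he : 0 ≤ e) (hu : IsUnit e) :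
    ∃ r : ℝ, 0 < r ∧ (r : ℂ) • (1 : A) ≤ e := by
  rcases subsingleton_or_nontrivial A with _ | _
  · exact ⟨1, one_pos, (Subsingleton.elim _ _).le⟩
  obtain ⟨r, hr, h⟩ := (CFC.exists_pos_algebraMap_le_iff he.isSelfAdjoint).2 fun x hx =>
    (hu.isStrictlyPositive he).spectrum_pos hx
  refine ⟨r, hr, ?_⟩
  rwa [Complex.coe_smul, ← Algebra.algebraMap_eq_smul_one]

lemma isUnit_of_pos_smul_le {e f : A} (he : 0 ≤ e) (hu : IsUnit e) {r : ℝ} (hr : 0 < r)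
    (h : (r : ℂ) • e ≤ f) : IsUnit f := by
  refine CStarAlgebra.isUnit_of_le ((r : ℂ) • e) h ?_
  have hr' : (r : ℂ) ≠ 0 := by exact_mod_cast hr.ne'
  refine IsUnit.isStrictlyPositive ?_ (smul_nonneg (by exact_mod_cast hr.le) he)
  exact hu.smul (Units.mk0 _ hr')

/-- Bounded positive `M`-preserving linear maps on `L¹(M, τ)` with boundedly invertible value
at `1`. -/
structure IsRegular (γ : LOne τ → LOne τ) : Prop where
  bounded : IsBoundedLinearMap ℂ γ
  pos : LOne.PositiveMap γ
  pres : LOne.AlgPreserving γ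
  inv : LOne.BoundedlyInvertible (γ (LOne.incl τ 1))

namespace IsRegular
variable {γ : LOne τ → LOne τ} (h : IsRegular γ)
include h

lemma incl_toAlg (a : A) : LOne.incl τ (LOne.toAlg (γ (LOne.incl τ a))) = γ (LOne.incl τ a) := by
  obtain ⟨b, hb⟩ := h.pres a
  rw [hb, LOne.toAlg_incl]

/-- The restriction to `M`. -/
noncomputable def algMap {γ : LOne τ → LOne τ} (h : IsRegular γ) : A →ₗ[ℂ] A where
  toFun a := LOne.toAlg (γ (LOne.incl τ a))
  map_add' a b := LOne.incl_injective τ (by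
    rw [h.incl_toAlg, map_add, map_add, h.incl_toAlg, h.incl_toAlg, h.bounded.map_add])
  map_smul' z a := LOne.incl_injective τ (by
    rw [RingHom.id_apply, h.incl_toAlg, map_smul, map_smul, h.incl_toAlg, h.bounded.map_smul])

lemma incl_algMap (a : A) : LOne.incl τ (h.algMap a) = γ (LOne.incl τ a) := h.incl_toAlg a

lemma algMap_nonneg {a : A} (ha : 0 ≤ a) : 0 ≤ h.algMap a := by
  rw [← LOne.isPos_incl_iff (τ := τ), h.incl_algMap]
  exact h.pos _ (LOne.isPos_incl_iff.2 ha)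

lemma isUnit_algMap_one : IsUnit (h.algMap 1) := by
  obtain ⟨b, h1, h2⟩ := h.inv
  rw [← h.incl_algMap, LOne.conj_incl] at h1 h2
  refine ⟨⟨h.algMap 1, b, ?_, ?_⟩, rfl⟩
  · simpa using LOne.incl_injective τ h1
  · simpa using LOne.incl_injective τ h2

lemma tr_incl (a b : A) : LOne.tr (γ (LOne.incl τ a)) b = τ (h.algMap a * b) := by
  rw [← h.incl_algMap, LOne.tr_incl]

lemma exists_bound : ∃ K : ℝ, 0 ≤ K ∧ ∀ a, 0 ≤ a → ∀ b,
    ‖τ (h.algMap a * b)‖ ≤ K * ‖b‖ * (τ a).re := by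
  obtain ⟨K, hK, hb⟩ := h.bounded.bound
  refine ⟨K, hK.le, fun a ha b => ?_⟩
  rw [← h.tr_incl]
  refine (LOne.norm_tr_le _ _).trans ?_
  have := hb (LOne.incl τ a)
  rw [LOne.norm_incl_eq, τ.norm₁_of_nonneg ha] at this
  calc _ ≤ ‖b‖ * (K * (τ a).re) := by gcongr
    _ = _ := by ring

lemma comp {γ' : LOne τ → LOne τ} (h' : IsRegular γ') : IsRegular (γ' ∘ γ) where
  bounded := h'.bounded.comp h.bounded
  pos x hx := h'.pos _ (h.pos x hx)
  pres a := ⟨h'.algMap (h.algMap a), by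
    rw [h'.incl_algMap, h.incl_algMap]; rfl⟩
  inv := by
    -- From r1 ≤ γ(1) with r > 0 follows r γ'(1) ≤ γ'(γ(1)), and an element above a positive
    -- invertible one is invertible.
    have hu : IsUnit (h'.algMap (h.algMap 1)) := by
      obtain ⟨r, hr, hle⟩ := exists_pos_smul_one_le (h.algMap_nonneg zero_le_one)
        h.isUnit_algMap_one
      refine isUnit_of_pos_smul_le (h'.algMap_nonneg zero_le_one) h'.isUnit_algMap_one hr ?_
      rw [← map_smul, ← sub_nonneg, ← map_sub]
      exact h'.algMap_nonneg (sub_nonneg.2 hle)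
    obtain ⟨u, hu⟩ := hu
    refine ⟨(u⁻¹ : Aˣ), ?_, ?_⟩
    · rw [Function.comp_apply, ← h.incl_algMap, ← h'.incl_algMap, LOne.conj_incl, ← hu]
      simp
    · rw [Function.comp_apply, ← h.incl_algMap, ← h'.incl_algMap, LOne.conj_incl, ← hu]
      simp

lemma algMap_comp {γ' : LOne τ → LOne τ} (h' : IsRegular γ') (hc : IsRegular (γ' ∘ γ)) (a : A) :
    hc.algMap a = h'.algMap (h.algMap a) := LOne.incl_injective τ (by
  rw [hc.incl_algMap, h'.incl_algMap, h.incl_algMap]; rfl)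

end IsRegular

section Iterates
variable {Ω : Type*} [MeasurableSpace Ω] {T : Ω ≃ᵐ Ω} {γ : Ω → LOne τ → LOne τ} {ω : Ω}

lemma isRegular_processAux (hr : ∀ k, IsRegular (γ (iter T k ω))) (m : ℤ) (k : ℕ) :
    IsRegular (processAux T γ m k ω) := by
  induction k with
  | zero => exact hr m
  | succ k ih => exact ih.comp (hr _)

/-- Harnack blocks recurring at arbitrarily late times lie beyond any prescribed stage of the
process started at m, so one recurrence statement serves every integer m. -/
lemma isContracting_processAux (hr : ∀ k, IsRegular (γ (iter T k ω))) {κ : ℝ} (h0 : 0 < κ)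
    (h1 : κ ≤ 1) {L : ℕ}
    (hv : ∃ᶠ n : ℕ in atTop, LOne.HarnackWith κ (processAux T γ n L ω)) (m : ℤ) :
    IsContracting τ fun k => (isRegular_processAux hr m k).algMap where
  map_nonneg n a ha := IsRegular.algMap_nonneg _ ha
  isUnit_map_one n := IsRegular.isUnit_algMap_one _
  succ_nonneg n a ha := by
    exact (IsRegular.algMap_nonneg (hr (m + (n + 1 : ℕ))) ha).trans_eq
      (IsRegular.algMap_comp (isRegular_processAux hr m n) (hr (m + (n + 1 : ℕ)))
        (isRegular_processAux hr m (n + 1)) a).symm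
  bound n := by
    obtain ⟨K, -, hK⟩ := (isRegular_processAux hr m n).exists_bound
    refine ⟨K * ‖(1 : A)‖, fun a ha => ?_⟩
    have := hK a ha 1
    rw [mul_one] at this
    exact (Complex.re_le_norm _).trans this
  harnack := by
    refine ⟨κ, h0, h1, fun N => ?_⟩
    obtain ⟨p, hH, hp⟩ := (hv.and_eventually
      (eventually_ge_atTop (m + N + 1).toNat)).exists
    -- Index j stands for the j + 1 maps at times m, …, m + j. The block of L + 1 maps starting at p
    -- = m + j + 1 therefore ends at index j + 1 + L.
    obtain ⟨j, hj⟩ : ∃ j : ℕ, (p : ℤ) = m + (j + 1 : ℕ) ∧ N ≤ j :=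
      ⟨(p - m - 1).toNat, by omega, by omega⟩
    refine ⟨j, hj.2, j + 1 + L, by omega, fun x y hx hy => ?_⟩
    rw [hj.1] at hH
    have e : ∀ z, LOne.incl τ ((isRegular_processAux hr m (j + 1 + L)).algMap z) =
        processAux T γ (m + (j + 1 : ℕ)) L ω
          (LOne.incl τ ((isRegular_processAux hr m j).algMap z)) := fun z => by
      rw [IsRegular.incl_algMap, IsRegular.incl_algMap, processAux_add]; rfl
    have h2 := hH _ _ (LOne.isPos_incl_iff.2 hx) (LOne.isPos_incl_iff.2 hy)
    rw [← e, ← e, LOne.tr_incl, LOne.tr_incl, mul_one, mul_one] at h2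
    refine (LOne.isPos_incl_iff (τ := τ)).1 ?_
    rw [map_sub, map_smul, map_smul]
    exact h2

/-- `b` represents the limit of the normalized functionals `a ↦ τ(Γ_{n,m}(a)) / τ(Γ_{n,m}(1))`. -/
def IsLimitState (T : Ω ≃ᵐ Ω) (γ : Ω → LOne τ → LOne τ) (m : ℤ) (ω : Ω) (b : A) : Prop :=
  b ∈ LOne.boundedStates τ ∧ ∀ a : A, Tendsto (fun k : ℕ =>
    LOne.tr (processAux T γ m k ω (LOne.incl τ a)) 1 /
      LOne.tr (processAux T γ m k ω (LOne.incl τ 1)) 1) atTop (𝓝 (τ (a * b)))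

lemma IsLimitState.unique {m : ℤ} {b c : A} (hb : IsLimitState T γ m ω b)
    (hc : IsLimitState T γ m ω c) : b = c := by
  refine sub_eq_zero.1 (τ.eq_zero_of_map_mul fun a => ?_)
  rw [τ.tracial, mul_sub, τ.map_sub, tendsto_nhds_unique (hb.2 a) (hc.2 a), sub_self]

lemma one_mem_boundedStates : (1 : A) ∈ LOne.boundedStates τ :=
  ⟨LOne.isPos_incl_iff.2 zero_le_one, by rw [LOne.tr_incl, mul_one, τ.map_one]⟩

lemma mem_boundedStates {b : A} (hb : 0 ≤ b) (h1 : τ b = 1) : b ∈ LOne.boundedStates τ :=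
  ⟨LOne.isPos_incl_iff.2 hb, by rw [LOne.tr_incl, mul_one, h1]⟩

/-- An element with the property `p`, or `1` if there is none. -/
noncomputable def chooseOrOne (p : A → Prop) : A :=
  open Classical in if h : ∃ b, p b then h.choose else 1

/-- The random bounded state `B_m`, with the value `1` where the limit does not exist. -/
noncomputable def limitState (T : Ω ≃ᵐ Ω) (γ : Ω → LOne τ → LOne τ) (m : ℤ) (ω : Ω) : A :=
  chooseOrOne (IsLimitState T γ m ω)

lemma limitState_mem (m : ℤ) (ω : Ω) : limitState T γ m ω ∈ LOne.boundedStates τ := by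
  rw [limitState, chooseOrOne]
  split_ifs with h
  · exact h.choose_spec.1
  · exact one_mem_boundedStates

lemma isLimitState_limitState {m : ℤ} (h : ∃ b : A, IsLimitState T γ m ω b) :
    IsLimitState T γ m ω (limitState T γ m ω) := by
  rw [limitState, chooseOrOne, dif_pos h]
  exact h.choose_spec

lemma limitState_iter (m j : ℤ) : limitState T γ m (iter T j ω) = limitState T γ (m + j) ω := by
  have e : IsLimitState T γ m (iter T j ω) = IsLimitState (τ := τ) T γ (m + j) ω := by
    ext b
    simp only [IsLimitState, processAux_iter]
  rw [limitState, limitState, e]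

end Iterates

section Bound

lemma FaithfulTrace.norm₁_star (τ : FaithfulTrace A) (a : A) : τ.norm₁ (star a) ≤ τ.norm₁ a := by
  refine le_of_forall_pos_le_add fun ε hε => ?_
  obtain ⟨b, hb, h⟩ := τ.exists_norm₁_le (star a) hε
  refine h.trans ?_
  have e : ‖τ (star a * b)‖ = ‖τ (a * star b)‖ := by
    rw [← norm_star (τ (a * star b)), ← τ.map_star, star_mul, star_star, τ.tracial]
  rw [e]
  gcongr
  refine (τ.norm_mul_le _ _).trans (mul_le_of_le_one_left (τ.norm₁_nonneg _) ?_)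
  rwa [norm_star]

/-- A linear map on `M` that is bounded by `K τ` on the positive cone is `‖·‖₁`-bounded. -/
lemma FaithfulTrace.norm_le_of_nonneg (τ : FaithfulTrace A) {E : Type*} [NormedAddCommGroup E]
    [NormedSpace ℂ E] (Φ : A →ₗ[ℂ] E) {K : ℝ} (hK : 0 ≤ K)
    (h : ∀ a, 0 ≤ a → ‖Φ a‖ ≤ K * (τ a).re) (a : A) : ‖Φ a‖ ≤ 2 * K * τ.norm₁ a := by
  have hsa : ∀ a, IsSelfAdjoint a → ‖Φ a‖ ≤ K * τ.norm₁ a := by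
    intro a ha
    -- Since |a| = a⁺ + a⁻, the self-adjoint case loses nothing; the factor 2 arises only from
    -- splitting into real and imaginary parts.
    rw [norm₁, ← CFC.posPart_add_negPart a ha, τ.map_add, Complex.add_re, mul_add]
    conv_lhs => rw [← CFC.posPart_sub_negPart a ha]
    rw [_root_.map_sub]
    exact (norm_sub_le _ _).trans
      (add_le_add (h _ (CFC.posPart_nonneg a)) (h _ (CFC.negPart_nonneg a)))
  have hs := τ.norm₁_star a
  have hre : τ.norm₁ (realPart a : A) ≤ τ.norm₁ a := by
    rw [realPart_apply_coe, ← Complex.coe_smul, τ.norm₁_smul, Complex.norm_real]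
    have := τ.norm₁_add_le a (star a)
    norm_num
    linarith
  have him : τ.norm₁ (imaginaryPart a : A) ≤ τ.norm₁ a := by
    rw [imaginaryPart_apply_coe, ← Complex.coe_smul, τ.norm₁_smul, τ.norm₁_smul, Complex.norm_real]
    have h1 := τ.norm₁_add_le a ((-1 : ℂ) • star a)
    rw [τ.norm₁_smul, neg_one_smul, ← sub_eq_add_neg] at h1
    norm_num at h1 ⊢
    linarith
  have h1 := hsa _ (realPart a).2
  have h2 := hsa _ (imaginaryPart a).2
  conv_lhs => rw [← realPart_add_I_smul_imaginaryPart a]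
  rw [_root_.map_add, _root_.map_smul]
  refine (norm_add_le _ _).trans ?_
  rw [norm_smul, Complex.norm_I, one_mul]
  calc _ ≤ K * τ.norm₁ a + K * τ.norm₁ a :=
        add_le_add (h1.trans (by gcongr)) (h2.trans (by gcongr))
    _ = _ := by ring

/-- Strong convergence to zero of uniformly bounded additive maps passes from a dense set to the
whole space. -/
lemma tendsto_norm_zero_of_denseRange {ι D E F : Type*} [NormedAddCommGroup E]
    [NormedAddCommGroup F] {l : Filter ι} {d : D → E} (hd : DenseRange d) {Ψ : ι → E → F} {C : ℝ}
    (hsub : ∀ i x y, Ψ i (x - y) = Ψ i x - Ψ i y) (hC : ∀ i x, ‖Ψ i x‖ ≤ C * ‖x‖)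
    (h : ∀ a, Tendsto (fun i => ‖Ψ i (d a)‖) l (𝓝 0)) (x : E) :
    Tendsto (fun i => ‖Ψ i x‖) l (𝓝 0) := by
  rw [Metric.tendsto_nhds]
  intro ε hε
  obtain ⟨a, ha⟩ := hd.exists_dist_lt x (show 0 < ε / (2 * (|C| + 1)) by positivity)
  rw [dist_eq_norm] at ha
  filter_upwards [(h a).eventually_lt_const (half_pos hε)] with i hi
  rw [dist_zero_right, norm_norm]
  have h1 : ‖Ψ i x‖ ≤ ‖Ψ i (x - d a)‖ + ‖Ψ i (d a)‖ := by
    rw [hsub]; simpa using norm_add_le (Ψ i x - Ψ i (d a)) (Ψ i (d a))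
  have h2 : ‖Ψ i (x - d a)‖ ≤ ε / 2 := by
    refine (hC i _).trans ?_
    rw [lt_div_iff₀ (by positivity)] at ha
    nlinarith [le_abs_self C, norm_nonneg (x - d a)]
  linarith

end Bound
end Regular

/-! ### Dual maps, equivariance and assembly. -/

section Main
variable {H : Type*} [NormedAddCommGroup H] [InnerProductSpace ℂ H] [CompleteSpace H]
  {M : VonNeumannAlgebra H} {τ : FaithfulTrace M}

/-- The functional a ↦ τ(γ(a)b) is positive and, by ‖·‖₁-boundedness of γ, dominated by a multiple
of τ; its density is γ*(b). The identity extends from M to L¹ by continuity. -/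
lemma IsRegular.exists_dual (hτ : IsNormal M τ) {γ : LOne τ → LOne τ} (h : IsRegular γ) {b : M}
    (hb : 0 ≤ b) : ∃ c : M, 0 ≤ c ∧ ∀ x, LOne.tr (γ x) b = LOne.tr x c := by
  obtain ⟨K, -, hK⟩ := h.exists_bound
  obtain ⟨c, hc, hφ⟩ := τ.exists_density hτ
    (τ.toPositiveLinearMap.toLinearMap ∘ₗ LinearMap.mulRight ℂ b ∘ₗ h.algMap)
    (fun a ha => τ.map_mul_nonneg (h.algMap_nonneg ha) hb)
    (C := K * ‖b‖) (fun a ha => (Complex.re_le_norm _).trans (hK a ha b))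
  refine ⟨c, hc, fun x => ?_⟩
  refine LOne.induction_incl x (isClosed_eq ((LOne.continuous_tr b).comp h.bounded.continuous)
    (LOne.continuous_tr c)) fun a => ?_
  rw [Function.comp_apply, h.tr_incl, LOne.tr_incl]
  exact hφ a

variable {Ω : Type*} [MeasurableSpace Ω] {T : Ω ≃ᵐ Ω} {γ : Ω → LOne τ → LOne τ} {ω : Ω}

lemma IsContracting.exists_isLimitState (hτ : IsNormal M τ) (hr : ∀ k, IsRegular (γ (iter T k ω)))
    (m : ℤ) (hc : IsContracting τ fun k => (isRegular_processAux hr m k).algMap) :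
    ∃ b : M, IsLimitState T γ m ω b := by
  obtain ⟨φ, hlim, hpos, hone, C, hC⟩ := hc.exists_limit
  obtain ⟨b, hb, hφ⟩ := τ.exists_density hτ φ hpos hC
  refine ⟨b, mem_boundedStates hb (by rw [← one_mul b, ← hφ, hone]), fun a => ?_⟩
  rw [← hφ]
  refine (hlim a).congr fun k => ?_
  rw [IsContracting.ratio_apply, (isRegular_processAux hr m k).tr_incl,
    (isRegular_processAux hr m k).tr_incl, mul_one, mul_one]

lemma IsContracting.tendsto_conj (hr : ∀ k, IsRegular (γ (iter T k ω)))
    (m : ℤ) (hc : IsContracting τ fun k => (isRegular_processAux hr m k).algMap) {b : M}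
    (hb : IsLimitState T γ m ω b) (a : M) :
    Tendsto (fun k => ‖invSqrtOne (processAux T γ m k ω) *
      LOne.toAlg (processAux T γ m k ω (LOne.incl τ a)) * invSqrtOne (processAux T γ m k ω) -
        τ (a * b) • (1 : M)‖) atTop (𝓝 0) := by
  refine tendsto_iff_norm_sub_tendsto_zero.1 (hc.tendsto_conj_of_tendsto_ratio
    (φ := τ.toPositiveLinearMap.toLinearMap ∘ₗ LinearMap.mulRight ℂ b) (fun a => ?_) a)
  refine (hb.2 a).congr fun k => ?_
  rw [IsContracting.ratio_apply, (isRegular_processAux hr m k).tr_incl,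
    (isRegular_processAux hr m k).tr_incl, mul_one, mul_one]

lemma nonneg_of_mem_boundedStates {b : M} (hb : b ∈ LOne.boundedStates τ) : 0 ≤ b :=
  LOne.isPos_incl_iff.1 hb.1

lemma map_eq_one_of_mem_boundedStates {b : M} (hb : b ∈ LOne.boundedStates τ) : τ b = 1 := by
  have := hb.2
  rwa [LOne.tr_incl, mul_one] at this

/-- The pullback of the limit state along the first map of the process. -/
lemma IsLimitState.pred (hτ : IsNormal M τ) {m : ℤ} {b : M} (hb : IsLimitState T γ m ω b)
    (hr : IsRegular (γ (iter T (m - 1) ω))) :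
    IsLimitState T γ (m - 1) ω (LOne.dualProjAct (γ (iter T (m - 1) ω)) b) := by
  set g := γ (iter T (m - 1) ω) with hg
  have hb0 := nonneg_of_mem_boundedStates hb.1
  obtain ⟨c, hc, hdual⟩ := hr.exists_dual hτ hb0
  have ec : ∀ a, τ (hr.algMap a * b) = τ (a * c) := fun a => by
    rw [← hr.tr_incl, hdual, LOne.tr_incl]
  -- With γ(1) ≥ r1, one has τ(c) = τ(γ(1)b) ≥ rτ(b) = r > 0, so the normalization is legitimate.
  have hcpos : τ c ≠ 0 := by
    obtain ⟨r, hrpos, hle⟩ := exists_pos_smul_one_le (hr.algMap_nonneg zero_le_one)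
      hr.isUnit_algMap_one
    have h1 := τ.map_mul_nonneg (sub_nonneg.2 hle) hb0
    rw [sub_mul, τ.map_sub, smul_mul_assoc, one_mul, τ.map_smul,
      map_eq_one_of_mem_boundedStates hb.1, mul_one, ec, one_mul, sub_nonneg] at h1
    exact ((by exact_mod_cast hrpos : (0 : ℂ) < r).trans_le h1).ne'
  have hd : LOne.dualProjAct g b = (τ c)⁻¹ • c := by
    rw [LOne.dualProjAct, LOne.dual_eq hdual]
  rw [hd]
  refine ⟨mem_boundedStates ?_ ?_, fun a => ?_⟩
  · exact smul_nonneg (by simpa using inv_nonneg.2 (τ.map_nonneg hc)) hc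
  · rw [τ.map_smul, inv_mul_cancel₀ hcpos]
  -- The process started at m - 1 has one more map, hence the index shift. Its ratio at a is the
  -- quotient of the ratios of the process started at m, taken at γ(a) and γ(1).
  · rw [← tendsto_add_atTop_iff_nat 1]
    have h1 := hb.2 (hr.algMap a)
    have h2 := hb.2 (hr.algMap 1)
    rw [ec] at h1 h2
    rw [one_mul] at h2
    have h3 := h1.div h2 hcpos
    rw [mul_smul_comm, τ.map_smul, ← div_eq_inv_mul]
    have h4 := h2.eventually_ne hcpos
    refine h3.congr' ?_
    filter_upwards [h4] with k hk
    rw [processAux_pred, Function.comp_apply, Function.comp_apply, ← hg, ← hr.incl_algMap,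
      ← hr.incl_algMap, Pi.div_apply]
    -- The common denominator is non-zero, since otherwise the ratio at γ(1) would be 0, against its
    -- eventual non-vanishing.
    refine div_div_div_cancel_right₀ (fun h0 => hk ?_) _ _
    rw [h0, div_zero]

/-- `‖Γ(1)^{-1/2} Γ(x) Γ(1)^{-1/2}‖₁ ≤ 2 ‖Γ*(Γ(1)⁻¹)‖ ‖x‖₁`. -/
lemma IsRegular.norm_conj_invSqrtOne_le (hτ : IsNormal M τ) {Γ : LOne τ → LOne τ}
    (h : IsRegular Γ) {K : ℝ} (hK : ‖LOne.dual Γ (invOne Γ)‖ ≤ K) (x : LOne τ) :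
    ‖LOne.conj (invSqrtOne Γ) (Γ x) (invSqrtOne Γ)‖ ≤ 2 * K * ‖x‖ := by
  set e := h.algMap 1 with he
  set s := invSqrtOne Γ with hs
  have hse : s = e ^ (-(1 / 2) : ℝ) := rfl
  have hi : invOne Γ = Ring.inverse e := rfl
  have he0 : 0 ≤ e := h.algMap_nonneg zero_le_one
  have hsp := h.isUnit_algMap_one.isStrictlyPositive he0
  have hss : s * s = Ring.inverse e := by
    rw [hse, ← CFC.rpow_add h.isUnit_algMap_one, CFC.inverse_eq_rpow_neg_one hsp]
    norm_num
  have hstar : star s = s := (CFC.rpow_nonneg (a := e)).isSelfAdjoint.star_eq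
  obtain ⟨c, hc, hdual⟩ := h.exists_dual hτ hsp.ringInverse.nonneg
  rw [hi, LOne.dual_eq hdual] at hK
  have hK0 : 0 ≤ K := (norm_nonneg _).trans hK
  let Φ : M →ₗ[ℂ] LOne τ :=
    (LOne.conjL s s).toLinearMap ∘ₗ LOne.incl τ ∘ₗ h.algMap
  have hΦ : ∀ a, Φ a = LOne.incl τ (s * h.algMap a * s) := fun a => LOne.conj_incl _ _ _
  -- For a ≥ 0 the norm is the trace τ(sΓ(a)s) = τ(Γ(a)Γ(1)⁻¹) = τ(aΓ*(Γ(1)⁻¹)).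
  have hpos : ∀ a, 0 ≤ a → ‖Φ a‖ ≤ K * (τ a).re := by
    intro a ha
    have h1 : 0 ≤ s * h.algMap a * s := by
      have := star_left_conjugate_nonneg (h.algMap_nonneg ha) s
      rwa [hstar] at this
    rw [hΦ, LOne.norm_incl_eq, τ.norm₁_of_nonneg h1, mul_assoc, τ.tracial, mul_assoc, hss,
      ← h.tr_incl, hdual, LOne.tr_incl]
    refine (Complex.re_le_norm _).trans ((τ.norm_mul_le a c).trans ?_)
    rw [τ.norm₁_of_nonneg ha]
    exact mul_le_mul_of_nonneg_right hK (Complex.le_def.1 (τ.map_nonneg ha)).1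
  refine LOne.induction_incl x (isClosed_le
    ((LOne.continuous_conj s s).comp h.bounded.continuous).norm
    (continuous_const.mul continuous_norm)) fun a => ?_
  have := τ.norm_le_of_nonneg Φ hK0 hpos a
  rw [hΦ, ← LOne.conj_incl, h.incl_algMap, ← LOne.norm_incl_eq] at this
  exact this

/-- The dual bound makes the conjugated maps equicontinuous on L¹. On the dense subspace M, operator
norm convergence is already known and dominates ‖·‖₁. -/
lemma IsContracting.tendsto_conj_norm (hτ : IsNormal M τ) (hr : ∀ k, IsRegular (γ (iter T k ω)))
    (m : ℤ) (hc : IsContracting τ fun k => (isRegular_processAux hr m k).algMap) {b : M}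
    (hb : IsLimitState T γ m ω b) {K : ℝ}
    (hK : ∀ k, ‖LOne.dual (processAux T γ m k ω) (invOne (processAux T γ m k ω))‖ ≤ K)
    (x : LOne τ) :
    Tendsto (fun k => ‖LOne.conj (invSqrtOne (processAux T γ m k ω)) (processAux T γ m k ω x)
      (invSqrtOne (processAux T γ m k ω)) - LOne.tr x b • LOne.incl τ 1‖) atTop (𝓝 0) := by
  refine tendsto_norm_zero_of_denseRange (LOne.denseRange_incl τ)
    (Ψ := fun k x => LOne.conj (invSqrtOne (processAux T γ m k ω)) (processAux T γ m k ω x)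
      (invSqrtOne (processAux T γ m k ω)) - LOne.tr x b • LOne.incl τ 1)
    (C := 2 * K + ‖b‖ * ‖LOne.incl τ (1 : M)‖) (fun k x y => ?_) (fun k x => ?_) (fun a => ?_) x
  · rw [(isRegular_processAux hr m k).bounded.map_sub, ← LOne.conjL_apply, ← LOne.conjL_apply,
      ← LOne.conjL_apply, map_sub, LOne.tr_sub, sub_smul]
    abel
  · refine (norm_sub_le _ _).trans ?_
    rw [norm_smul, add_mul]
    refine add_le_add ((isRegular_processAux hr m k).norm_conj_invSqrtOne_le hτ (hK k) x) ?_
    calc _ ≤ ‖b‖ * ‖x‖ * ‖LOne.incl τ (1 : M)‖ := by gcongr; exact LOne.norm_tr_le x b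
      _ = _ := by ring
  · refine squeeze_zero (fun _ => norm_nonneg _) (fun k => ?_) (hc.tendsto_conj hr m hb a)
    refine le_trans (le_of_eq ?_) (LOne.norm_incl_le (τ := τ) _)
    rw [map_sub, map_smul, LOne.tr_incl, ← LOne.conj_incl,
      (isRegular_processAux hr m k).incl_toAlg]

lemma tendsto_process_of_tendsto_processAux {X : Type*} [NormedAddCommGroup X] [NormedSpace ℂ X] {T : Ω ≃ᵐ Ω}
    {γ : Ω → X → X} {m : ℤ} {F : (X → X) → ℝ}
    (h : Tendsto (fun k : ℕ => F (processAux T γ m k ω)) atTop (𝓝 0)) :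
    Tendsto (fun n : ℤ => F (process T γ n m ω)) atTop (𝓝 0) := by
  have : Tendsto (fun n : ℤ => (n - m).toNat) atTop atTop := by
    refine tendsto_atTop.2 fun b => ?_
    filter_upwards [eventually_ge_atTop (m + b)] with n hn
    omega
  exact h.comp this

/-- Almost surely, blocks of a fixed length with a fixed Harnack constant occur infinitely often. -/
lemma exists_ae_frequently_harnackWith {A : Type*} [CStarAlgebra A] [PartialOrder A]
    [StarOrderedRing A] {τ : FaithfulTrace A} [TopologicalSpace.SeparableSpace (LOne τ)]
    {P : Measure Ω} [IsProbabilityMeasure P] (hT : Ergodic T P)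
    {γ : Ω → LOne τ → LOne τ} (hγ : IsBoundedRandomLinearOperator P γ)
    (hr : ∀ᵐ ω ∂P, ∀ k, IsRegular (γ (iter T k ω)))
    (hSHC : 0 < P {ω | ∃ n m : ℤ, m ≤ n ∧ process T γ n m ω ∈ LOne.SHC τ}) :
    ∃ (L : ℕ) (κ : ℝ), 0 < κ ∧ κ ≤ 1 ∧
      ∀ᵐ ω ∂P, ∃ᶠ n : ℕ in atTop, LOne.HarnackWith κ (processAux T γ n L ω) := by
  let E : ℕ → ℕ → Set Ω := fun L j =>
    {ω | LOne.HarnackWith (1 / (j + 1 : ℝ)) (processAux T γ 0 L ω)}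
  have hE : ∀ L j, NullMeasurableSet (E L j) P := fun L j =>
    LOne.nullMeasurableSet_harnackWith
      (aestronglyMeasurable_processAux hT.toMeasurePreserving hγ 0 L)
      (hr.mono fun ω h => (isRegular_processAux h 0 L).bounded.continuous) _
  have hsub : {ω | ∃ n m : ℤ, m ≤ n ∧ process T γ n m ω ∈ LOne.SHC τ} ⊆
      ⋃ m : ℤ, ⋃ L : ℕ, ⋃ j : ℕ, iter T m ⁻¹' E L j := by
    rintro ω ⟨n, m, -, h⟩
    obtain ⟨j, hj⟩ := LOne.exists_harnackWith_of_mem_SHC h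
    simp only [Set.mem_iUnion]
    refine ⟨m, (n - m).toNat, j, ?_⟩
    change LOne.HarnackWith _ _
    rw [processAux_iter, zero_add]
    exact hj
  -- If all events E L j were null, so would be their translates by the powers of T, and the SHC
  -- event is covered by countably many of these.
  obtain ⟨L, j, h0⟩ : ∃ L j, P (E L j) ≠ 0 := by
    by_contra! hne
    refine (hSHC.trans_le (measure_mono hsub)).ne' ?_
    refine measure_iUnion_null fun m => measure_iUnion_null fun L => measure_iUnion_null fun j => ?_
    rw [(measurePreserving_iter hT.toMeasurePreserving m).measure_preimage (hE L j)]
    exact hne L j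
  refine ⟨L, 1 / (j + 1 : ℝ), by positivity, ?_, ?_⟩
  · rw [div_le_one (by positivity)]
    linarith [(Nat.cast_nonneg j : (0 : ℝ) ≤ j)]
  · filter_upwards [ae_frequently_mem_of_ergodic hT (hE L j) h0] with ω hω
    refine hω.mono fun n hn => ?_
    rw [← iter_natCast] at hn
    change LOne.HarnackWith _ _ at hn
    rwa [processAux_iter, zero_add] at hn

/-- Each pairing with a fixed a is an almost sure limit of measurable ratios, so weak measurability
suffices. -/
lemma aestronglyMeasurable_limitState [TopologicalSpace.SeparableSpace (LOne τ)] {P : Measure Ω}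
    (hT : MeasurePreserving T P P) (hγ : IsBoundedRandomLinearOperator P γ) (m : ℤ)
    (h : ∀ᵐ ω ∂P, ∃ b : M, IsLimitState T γ m ω b) :
    AEStronglyMeasurable (fun ω => LOne.incl τ (limitState T γ m ω)) P := by
  refine LOne.aestronglyMeasurable_of_tr fun a => ?_
  have ht : ∀ k x, AEMeasurable (fun ω => LOne.tr (processAux T γ m k ω x) 1) P := fun k x =>
    ((LOne.continuous_tr 1).comp_aestronglyMeasurable
      (aestronglyMeasurable_processAux hT hγ m k x)).aemeasurable
  refine aemeasurable_of_tendsto_metrizable_ae atTop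
    (fun k : ℕ => (ht k (LOne.incl τ a)).div (ht k (LOne.incl τ 1))) ?_
  filter_upwards [h] with ω hω
  rw [LOne.tr_incl, τ.tracial]
  exact (isLimitState_limitState hω).2 a

end Main
end EQP

theorem mainTheorem11
    {H : Type*} [NormedAddCommGroup H] [InnerProductSpace ℂ H] [CompleteSpace H]
    (M : VonNeumannAlgebra H) (τ : FaithfulTrace M) (hτ : IsNormal M τ)
    [TopologicalSpace.SeparableSpace (LOne τ)]
    {Ω : Type*} [MeasurableSpace Ω] (P : Measure Ω) [IsProbabilityMeasure P]
    (T : Ω ≃ᵐ Ω) (hT : Ergodic T P)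
    (γ : Ω → LOne τ → LOne τ) (hγ : IsBoundedRandomLinearOperator P γ)
    (hγ_pos : ∀ᵐ ω ∂P, LOne.PositiveMap (γ ω))
    (hγ_faithful : ∀ᵐ ω ∂P, LOne.FaithfulMap (γ ω))
    (hγ_pres : ∀ᵐ ω ∂P, LOne.AlgPreserving (γ ω))
    (hγ_inv : ∀ᵐ ω ∂P, LOne.BoundedlyInvertible (γ ω (LOne.incl τ 1)))
    (hSHC : 0 < P {ω | ∃ n m : ℤ, m ≤ n ∧ process T γ n m ω ∈ LOne.SHC τ}) :
    ∃ B : ℤ → Ω → M,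
      (∀ m ω, B m ω ∈ LOne.boundedStates τ) ∧
      (∀ m, AEStronglyMeasurable (fun ω => LOne.incl τ (B m ω)) P) ∧
      (∀ᵐ ω ∂P, ∀ m : ℤ,
        LOne.dualProjAct (γ (iter T (m - 1) ω)) (B m ω) = B (m - 1) ω ∧
        B m (T ω) = B (m + 1) ω ∧ B m (T.symm ω) = B (m - 1) ω) ∧
      (∀ a : M, ∀ᵐ ω ∂P, ∀ m : ℤ,
        Tendsto (fun n : ℤ =>
          ‖invSqrtOne (process T γ n m ω) * LOne.toAlg (process T γ n m ω (LOne.incl τ a)) *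
              invSqrtOne (process T γ n m ω) - τ (a * B m ω) • (1 : M)‖) atTop (𝓝 0)) ∧
      (∀ m : ℤ,
        (∀ᵐ ω ∂P, BddAbove {r : ℝ | ∃ n : ℤ, m ≤ n ∧
          r = ‖LOne.dual (process T γ n m ω) (invOne (process T γ n m ω))‖}) →
        ∀ x ∈ LOne.states τ, ∀ᵐ ω ∂P,
          Tendsto (fun n : ℤ =>
            ‖LOne.conj (invSqrtOne (process T γ n m ω)) (process T γ n m ω x)
                (invSqrtOne (process T γ n m ω)) -
              LOne.tr x (B m ω) • LOne.incl τ 1‖) atTop (𝓝 0)) := by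
  have hr : ∀ᵐ ω ∂P, ∀ k, IsRegular (γ (iter T k ω)) := by
    refine ae_all_iff.2 fun k => ?_
    refine (measurePreserving_iter hT.toMeasurePreserving k).quasiMeasurePreserving.ae
      (p := fun ω => IsRegular (γ ω)) ?_
    filter_upwards [hγ.isBoundedLinearMap, hγ_pos, hγ_pres, hγ_inv] with ω h1 h2 h3 h4
    exact ⟨h1, h2, h3, h4⟩
  obtain ⟨L, κ, hκ0, hκ1, hv⟩ := exists_ae_frequently_harnackWith hT hγ hr hSHC
  have hlim : ∀ᵐ ω ∂P, ∀ m, IsLimitState T γ m ω (limitState T γ m ω : M) := by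
    filter_upwards [hr, hv] with ω hω hvω m
    exact isLimitState_limitState
      ((isContracting_processAux hω hκ0 hκ1 hvω m).exists_isLimitState hτ hω m)
  refine ⟨fun m ω => limitState T γ m ω, fun m ω => limitState_mem m ω, fun m => ?_, ?_, ?_, ?_⟩
  · exact aestronglyMeasurable_limitState hT.toMeasurePreserving hγ m
      (hlim.mono fun ω h => ⟨_, h m⟩)
  · filter_upwards [hr, hlim] with ω hω hl m
    -- Both the pulled-back state and B_{m-1} are limit states of the process started at m - 1.
    refine ⟨((hl m).pred hτ (hω (m - 1))).unique (hl (m - 1)), ?_, ?_⟩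
    · rw [← iter_one, limitState_iter]
    · rw [← iter_neg_one, limitState_iter, sub_eq_add_neg]
  · intro a
    filter_upwards [hr, hv, hlim] with ω hω hvω hl m
    exact tendsto_process_of_tendsto_processAux (F := fun G => ‖invSqrtOne G * LOne.toAlg (G (LOne.incl τ a)) *
      invSqrtOne G - τ (a * limitState T γ m ω) • (1 : M)‖)
      ((isContracting_processAux hω hκ0 hκ1 hvω m).tendsto_conj hω m (hl m) a)
  · intro m hb x _
    filter_upwards [hr, hv, hlim, hb] with ω hω hvω hl ⟨K, hK⟩
    refine tendsto_process_of_tendsto_processAux (F := fun G => ‖LOne.conj (invSqrtOne G) (G x) (invSqrtOne G) -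
      LOne.tr x (limitState T γ m ω) • LOne.incl τ 1‖)
      ((isContracting_processAux hω hκ0 hκ1 hvω m).tendsto_conj_norm hτ hω m (hl m)
        (K := K) (fun k => hK ⟨m + k, by omega, ?_⟩) x)
    rw [process, show (m + k - m).toNat = k by omega]
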